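/- Let $d$ be a dimension and, for every finite $A\subset\mathbb Z^d$ and $i\in\{1,2\}$, let $J^i_A\ge 0$. Measure distances in $\mathbb Z^d$ with any fixed norm of $\mathbb R^d$, and assume that the couplings have finite range: there is $R\in[0,\infty)$ such that $J^i_A=0$ whenever $\operatorname{diam}A>R$. Let $S^1,S^2$ be the spin-$\tfrac12$ operators on $\mathbb C^2$ (half the Pauli matrices $\sigma^1,\sigma^2$). For finite $V\subset\mathbb Z^d$, let $\mathcal H_V=\bigotimes_{x\in V}\mathbb C^2$ and, for $x\in V$, let $S^i_x=S^i\otimes 1_{V\setminus\{x\}}$ on $\mathcal H_V$. For finite $\Lambda\subset\mathbb Z^d$ let $\Lambda_R=\{x\in\mathbb Z^d:\operatorname{dist}(x,\Lambda)\le R\}$ (with $\Lambda_R=\emptyset$ if $\Lambda=\emptyset$) and, for $\eta\in\mathbb R$, let $$H^\eta_{\Lambda_R}=-\sum_{A\subset\Lambda_R}\Bigl(J^1_A\prod_{x\in A}S^1_x+J^2_A\prod_{x\in A}S^2_x\Bigr)-\eta\sum_{x\in\Lambda_R\setminus\Lambda}S^1_x .$$ For an operator $a$ on $\mathcal H_\Lambda$,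 identified with $a\otimes 1_{\Lambda_R\setminus\Lambda}$ on $\mathcal H_{\Lambda_R}$, the expectation in the Gibbs state with "$+$" boundary conditions is $$\langle a\rangle^{(+)}_\Lambda=\lim_{\eta\to\infty}\frac{\operatorname{Tr}_{\mathcal H_{\Lambda_R}} a\,e^{-H^\eta_{\Lambda_R}}}{\operatorname{Tr}_{\mathcal H_{\Lambda_R}} e^{-H^\eta_{\Lambda_R}}} .$$ Then this limit exists for all finite $\Lambda$ and all $a$, and for every finite $A\subset\mathbb Z^d$ and every $i\in\{1,2\}$ the expectation $\bigl\langle\prod_{x\in A}S^i_x\bigr\rangle^{(+)}_\Lambda$ converges as $\Lambda\nearrow\mathbb Z^d$; that is, there is a number $t$ such that $\bigl\langle\prod_{x\in A}S^i_x\bigr\rangle^{(+)}_{\Lambda_n}\to t$ as $n\to\infty$ along every increasing sequence $(\Lambda_n)$ of finite subsets of $\mathbb Z^d$ such that every finite subset of $\mathbb Z^d$ is contained in $\Lambda_n$ for all sufficiently large $n$. -/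

import Mathlib

open Filter Topology
open scoped NNReal

noncomputable section

namespace QuantumXY

/-! ### The lattice `ℤ^d`, distances, and limits over finite subsets -/

/-- Sites of the lattice `ℤ^d`. -/
abbrev Site (d : ℕ) : Type := Fin d → ℤ

/-- A norm on `ℝ^d`; it is used to measure distances between sites of `ℤ^d`
(e.g. the Euclidean norm, the `ℓ¹` norm or the sup norm). -/
structure SpaceNorm (d : ℕ) extends Seminorm ℝ (Fin d → ℝ) where
  eq_zero_of_eq_zero : ∀ v : Fin d → ℝ, toSeminorm v = 0 → v = 0

/-- The distance between two sites in the given norm. -/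
def siteDist {d : ℕ} (N : SpaceNorm d) (x y : Site d) : ℝ :=
  N.toSeminorm (fun k => (x k : ℝ) - (y k : ℝ))

theorem siteDist_self {d : ℕ} (N : SpaceNorm d) (x : Site d) : siteDist N x x = 0 := by
  have h : (fun k => (x k : ℝ) - (x k : ℝ)) = (0 : Fin d → ℝ) := by
    funext k; simp
  rw [siteDist, h, map_zero]

/-- Every norm on `ℝ^d` dominates a positive multiple of the sup norm. -/
theorem SpaceNorm.exists_bound {d : ℕ} (N : SpaceNorm d) :
    ∃ c : ℝ, 0 < c ∧ ∀ v : Fin d → ℝ, c * ‖v‖ ≤ N.toSeminorm v := by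
  have hc : Continuous (fun v => N.toSeminorm v) :=
    N.toSeminorm.convexOn.locallyLipschitz.continuous
  rcases (Metric.sphere (0 : Fin d → ℝ) 1).eq_empty_or_nonempty with he | hne
  · refine ⟨1, one_pos, fun v => ?_⟩
    have hv : v = 0 := by
      by_contra hv
      have hm : (‖v‖⁻¹ • v) ∈ Metric.sphere (0 : Fin d → ℝ) 1 := by
        simp [norm_smul, hv]
      rw [he] at hm
      exact hm
    simp [hv]
  · obtain ⟨u, hu, hmin⟩ :=
      (isCompact_sphere (0 : Fin d → ℝ) 1).exists_isMinOn hne hc.continuousOn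
    have hu1 : ‖u‖ = 1 := by simpa using hu
    have hpos : 0 < N.toSeminorm u := by
      refine lt_of_le_of_ne (apply_nonneg _ _) (fun h => ?_)
      have := N.eq_zero_of_eq_zero u h.symm
      rw [this, norm_zero] at hu1
      exact zero_ne_one hu1
    refine ⟨N.toSeminorm u, hpos, fun v => ?_⟩
    by_cases hv : v = 0
    · simp [hv]
    have hn : 0 < ‖v‖ := norm_pos_iff.mpr hv
    have hm : (‖v‖⁻¹ • v) ∈ Metric.sphere (0 : Fin d → ℝ) 1 := by
      simp [norm_smul, hv]
    have h1 : N.toSeminorm u ≤ N.toSeminorm (‖v‖⁻¹ • v) := hmin hm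
    rw [map_smul_eq_mul, norm_inv, norm_norm] at h1
    calc N.toSeminorm u * ‖v‖ ≤ (‖v‖⁻¹ * N.toSeminorm v) * ‖v‖ := by gcongr
      _ = N.toSeminorm v := by field_simp

theorem finite_setOf_siteDist_le {d : ℕ} (N : SpaceNorm d) (R : ℝ≥0) (Λ : Finset (Site d)) :
    {x : Site d | ∃ y ∈ Λ, siteDist N x y ≤ R}.Finite := by
  obtain ⟨c, hc, hN⟩ := N.exists_bound
  have hsub : {x : Site d | ∃ y ∈ Λ, siteDist N x y ≤ R} ⊆
      ⋃ y ∈ Λ, Metric.closedBall y (R / c) := by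
    rintro x ⟨y, hy, hxy⟩
    simp only [Set.mem_iUnion]
    refine ⟨y, hy, ?_⟩
    have h1 := (hN _).trans hxy
    have h2 : ‖fun k => (x k : ℝ) - (y k : ℝ)‖ ≤ R / c := by
      rw [le_div_iff₀ hc, mul_comm]; exact h1
    have h0 : (0 : ℝ) ≤ R / c := div_nonneg R.2 hc.le
    rw [Metric.mem_closedBall, dist_pi_le_iff h0]
    intro k
    rw [pi_norm_le_iff_of_nonneg h0] at h2
    have := h2 k
    rwa [Int.dist_eq, ← Real.norm_eq_abs]
  refine Set.Finite.subset (Set.Finite.biUnion Λ.finite_toSet fun y _ => ?_) hsub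
  exact (isCompact_closedBall y _).finite_of_discrete

/-- The enlarged domain `Λ_R = {x ∈ ℤ^d : dist(x, Λ) ≤ R}`. -/
def enlarge {d : ℕ} (N : SpaceNorm d) (R : ℝ≥0) (Λ : Finset (Site d)) : Finset (Site d) :=
  (finite_setOf_siteDist_le N R Λ).toFinset

theorem subset_enlarge {d : ℕ} (N : SpaceNorm d) (R : ℝ≥0) (Λ : Finset (Site d)) :
    Λ ⊆ enlarge N R Λ := by
  intro x hx
  simp only [enlarge, Set.Finite.mem_toFinset, Set.mem_ofPred_eq]
  exact ⟨x, hx, by rw [siteDist_self]; exact R.2⟩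

/-- The couplings `J^i_A` have range `R`: `J^i_A = 0` whenever `diam A > R`, i.e. whenever
`A` has two points at distance larger than `R`. -/
def HasRange {d : ℕ} (N : SpaceNorm d) (R : ℝ≥0) (J : Fin 2 → Finset (Site d) → ℝ) : Prop :=
  ∀ (i : Fin 2) (A : Finset (Site d)),
    (∃ x ∈ A, ∃ y ∈ A, (R : ℝ) < siteDist N x y) → J i A = 0

/-- `t_Λ → l` as `Λ ↗ ℤ^d`: convergence along every increasing sequence of finite subsets
that eventually contains each finite subset. -/
def TendstoInfiniteVolume {d : ℕ} (t : Finset (Site d) → ℂ) (l : ℂ) : Prop :=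
  ∀ Λ : ℕ → Finset (Site d), (∀ n, Λ n ⊆ Λ (n + 1)) →
    (∀ A : Finset (Site d), ∃ nA : ℕ, ∀ n ≥ nA, A ⊆ Λ n) →
    Tendsto (fun n => t (Λ n)) atTop (𝓝 l)

/-! ### Spin-1/2 operators -/

/-- Operators on `⊗_{x ∈ V} ℂ²`, as matrices in the product basis, whose elements are labelled
by the configurations `V → {0, 1}`. -/
abbrev Op {d : ℕ} (V : Finset (Site d)) : Type := Matrix (V → Fin 2) (V → Fin 2) ℂ

/-- The spin-1/2 operators `S¹ = σ¹/2` (index `0`) and `S² = σ²/2` (index `1`) on `ℂ²`. -/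
def spin : Fin 2 → Matrix (Fin 2) (Fin 2) ℂ :=
  ![(1 / 2 : ℂ) • !![0, 1; 1, 0], (1 / 2 : ℂ) • !![0, -Complex.I; Complex.I, 0]]

/-- The tensor product `⊗_{x ∈ V} M_x`. -/
def tensor {d : ℕ} {V : Finset (Site d)} (M : V → Matrix (Fin 2) (Fin 2) ℂ) : Op V :=
  Matrix.of fun σ τ => ∏ x, M x (σ x) (τ x)

theorem tensor_mul {d : ℕ} {V : Finset (Site d)} (M M' : V → Matrix (Fin 2) (Fin 2) ℂ) :
    tensor M * tensor M' = tensor (fun x => M x * M' x) := by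
  ext σ τ
  simp only [tensor, Matrix.mul_apply, Matrix.of_apply, ← Finset.prod_mul_distrib]
  rw [Finset.prod_univ_sum, Fintype.piFinset_univ]

/-- The operator `S^i_x = S^i ⊗ 1_{V ∖ {x}}`. -/
def siteSpin {d : ℕ} {V : Finset (Site d)} (i : Fin 2) (x : V) : Op V :=
  tensor (Function.update (fun _ => 1) x (spin i))

theorem commute_siteSpin {d : ℕ} {V : Finset (Site d)} (i : Fin 2) (x y : V) :
    Commute (siteSpin i x) (siteSpin i y) := by
  unfold siteSpin Commute SemiconjBy
  rw [tensor_mul, tensor_mul]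
  congr 1
  funext z
  by_cases hx : z = x <;> by_cases hy : z = y <;> simp [Function.update_apply, hx, hy]

theorem pairwise_commute_siteSpin {d : ℕ} {V : Finset (Site d)} (i : Fin 2) (s : Finset V) :
    (s : Set V).Pairwise (Function.onFun Commute fun x => siteSpin i x) :=
  fun x _ y _ _ => commute_siteSpin i x y

/-- The operator `∏_{x ∈ A} S^i_x` on `⊗_{x ∈ V} ℂ²`, for `A ⊆ V`
(for other `A` the product is over `x ∈ A ∩ V`). -/
def spinProd {d : ℕ} (V : Finset (Site d)) (i : Fin 2) (A : Finset (Site d)) : Op V :=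
  (A.subtype (· ∈ V)).noncommProd (fun x => siteSpin i x)
    (pairwise_commute_siteSpin i _)

/-- The identification of an operator `a` on `⊗_{x ∈ Λ} ℂ²` with the operator
`a ⊗ 1_{V ∖ Λ}` on `⊗_{x ∈ V} ℂ²`, for `Λ ⊆ V`. -/
def extend {d : ℕ} {Λ V : Finset (Site d)} (h : Λ ⊆ V) (a : Op Λ) : Op V :=
  Matrix.of fun σ τ =>
    a (fun x => σ ⟨x, h x.2⟩) (fun x => τ ⟨x, h x.2⟩) *
      (if ∀ x : V, (x : Site d) ∉ Λ → σ x = τ x then 1 else 0)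

/-! ### Gibbs states with `+` boundary conditions -/

/-- The hamiltonian `H^η_{Λ_R}` with field `η` in direction 1 on the exterior boundary
`Λ_R ∖ Λ`. -/
def hamiltonian {d : ℕ} (N : SpaceNorm d) (R : ℝ≥0) (J : Fin 2 → Finset (Site d) → ℝ)
    (Λ : Finset (Site d)) (η : ℝ) : Op (enlarge N R Λ) :=
  -(∑ A ∈ (enlarge N R Λ).powerset,
      ((J 0 A : ℂ) • spinProd (enlarge N R Λ) 0 A + (J 1 A : ℂ) • spinProd (enlarge N R Λ) 1 A))
    - (η : ℂ) • ∑ x ∈ Finset.univ.filter (fun x : {x // x ∈ enlarge N R Λ} => x.1 ∉ Λ),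
        siteSpin 0 x

/-- The expectation `Tr (a e^{-H}) / Tr e^{-H}` with `H = H^η_{Λ_R}`, of an operator `a` on
`⊗_{x ∈ Λ} ℂ²`; the traces are over `⊗_{x ∈ Λ_R} ℂ²`. -/
def fieldExpectation {d : ℕ} (N : SpaceNorm d) (R : ℝ≥0) (J : Fin 2 → Finset (Site d) → ℝ)
    (Λ : Finset (Site d)) (η : ℝ) (a : Op Λ) : ℂ :=
  Matrix.trace (extend (subset_enlarge N R Λ) a * NormedSpace.exp (-hamiltonian N R J Λ η)) /
    Matrix.trace (NormedSpace.exp (-hamiltonian N R J Λ η))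

/-- The Gibbs state with `+` boundary conditions, `⟨a⟩_Λ^{(+)}`: the limit `η → ∞` of
`fieldExpectation`. -/
def plusExpectation {d : ℕ} (N : SpaceNorm d) (R : ℝ≥0) (J : Fin 2 → Finset (Site d) → ℝ)
    (Λ : Finset (Site d)) (a : Op Λ) : ℂ :=
  limUnder atTop (fun η : ℝ => fieldExpectation N R J Λ η a)

end QuantumXY

end

/-!
The proof rests on a Ginibre inequality for the XY model and on an explicit form of the limit of
an infinite field.

*Correlation inequality.* On two copies of the system, consider `a ⊗ 1 ± 1 ⊗ a`. In a suitable basis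
of `ℂ² ⊗ ℂ²` (`siteBasis`) the four operators `S¹ ⊗ 1 ± 1 ⊗ S¹`, `S² ⊗ 1 + 1 ⊗ S²` and
`-(S² ⊗ 1 - 1 ⊗ S²)` all have nonnegative matrix elements. Operators with nonnegative matrix elements
in the product basis are closed under sums, products and exponentials and have nonnegative trace, and
`(ab) ⊗ 1 ± 1 ⊗ (ab)` is a positive combination of products of the sums and differences for `a`
and `b`; so the same signs hold for `∏ S^i_x` (`ginibrePos_spinProd`). If `-H ⊗ 1 - 1 ⊗ H'` lies in
this cone, then `Tr (a ⊗ 1 - 1 ⊗ a) e^{-H} ⊗ e^{-H'}` has a sign, which compares the expectations of `a`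
for `H` and `H'` (`ginibre_inequality`). In particular, applying the field `η` at more sites increases
the expectations of products of `S¹` and decreases those of products of `S²`
(`gibbs_boundaryField_le`).

*Infinite field.* Let `P` be the projection onto the ground states of the field term `K`, shifted so
that `K ≤ 0` and `K P = 0`. Then `e^{B + ηK} → P e^{PBP}` (`tendsto_exp_add_smul`). Here `PBP` is `P`
times an operator on `Λ`, obtained by replacing `S¹_x` by `1/2` and `S²_x` by `0` at the sites outside
`Λ`; so the limiting state on `Λ` is the Gibbs state of this effective Hamiltonian
(`tendsto_gibbs_boundaryField`). Since the couplings have range `R`, enlarging the outer volume beyond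
`Λ_R` only adds a constant to it (`exists_plusHam_eq`).

*Infinite volume.* For `Λ ⊆ Λ'`, both `+` states can therefore be realized in the volume `Λ'_R`, with
infinite fields outside `Λ` and outside `Λ'`. By the correlation inequality the expectations are
monotone in the volume; they are bounded, hence they converge.
-/

noncomputable section

namespace QuantumXY

/-! ### Exponentials in a strong field -/

section CStar

variable {A : Type*} [CStarAlgebra A] [PartialOrder A] [StarOrderedRing A]

theorem norm_exp_smul_le {M : A} (hM : IsSelfAdjoint M) {β : ℝ} (hβ : 0 ≤ β)
    (hMβ : M ≤ algebraMap ℝ A β) {s : ℝ} (h0 : 0 ≤ s) (h1 : s ≤ 1) :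
    ‖NormedSpace.exp (s • M)‖ ≤ Real.exp β := by
  have hsM : IsSelfAdjoint (s • M) := (IsSelfAdjoint.all s).smul hM
  rw [← CFC.real_exp_eq_normedSpace_exp hsM]
  refine norm_cfc_le (Real.exp_nonneg _) fun x hx => ?_
  rw [Real.norm_eq_abs, abs_of_pos (Real.exp_pos _), Real.exp_le_exp]
  refine (le_algebraMap_iff_spectrum_le (r := β) hsM).1 ?_ x hx
  calc s • M ≤ s • algebraMap ℝ A β := smul_le_smul_of_nonneg_left hMβ h0
    _ = algebraMap ℝ A (s * β) := by rw [map_mul, ← Algebra.smul_def]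
    _ ≤ algebraMap ℝ A β := algebraMap_mono A (by nlinarith)

/-- This holds since `|x e^x| ≤ 1` for `x ≤ 0`. -/
theorem norm_exp_mul_self_le {M : A} (hM : IsSelfAdjoint M) {β : ℝ} (hβ : 0 ≤ β)
    (hMβ : M ≤ algebraMap ℝ A β) :
    ‖NormedSpace.exp M * M‖ ≤ 1 + β * Real.exp β := by
  have h : NormedSpace.exp M * M = cfc (fun x : ℝ => Real.exp x * x) M := by
    rw [cfc_mul Real.exp (fun x => x) M, CFC.real_exp_eq_normedSpace_exp hM, cfc_id' ℝ M]
  rw [h]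
  refine norm_cfc_le (by positivity) fun x hx => ?_
  have hxβ : x ≤ β := (le_algebraMap_iff_spectrum_le (r := β) hM).1 hMβ x hx
  rw [Real.norm_eq_abs, abs_mul, abs_of_pos (Real.exp_pos _)]
  rcases le_total 0 x with hx0 | hx0
  · rw [abs_of_nonneg hx0]
    have : Real.exp x ≤ Real.exp β := Real.exp_le_exp.2 hxβ
    nlinarith [Real.exp_pos x]
  · rw [abs_of_nonpos hx0]
    have h1 : Real.exp x * Real.exp (-x) = 1 := by rw [← Real.exp_add]; simp
    have h2 := Real.add_one_le_exp (-x)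
    have h3 : 0 ≤ β * Real.exp β := by positivity
    nlinarith [Real.exp_pos x]

/-- An approximate intertwining relation `M Y ≈ Y C` yields `e^M Y ≈ Y e^C`, by interpolating
with `e^{(1-s)M} Y e^{sC}`. -/
theorem norm_mul_exp_sub_exp_mul_le {M Y C : A} (hM : IsSelfAdjoint M) (hC : IsSelfAdjoint C)
    {β : ℝ} (hβ : 0 ≤ β) (hMβ : M ≤ algebraMap ℝ A β) :
    ‖Y * NormedSpace.exp C - NormedSpace.exp M * Y‖ ≤
      Real.exp β * ‖M * Y - Y * C‖ * Real.exp ‖C‖ := by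
  have hd : ∀ s : ℝ, HasDerivAt
      (fun s : ℝ => NormedSpace.exp ((1 - s) • M) * Y * NormedSpace.exp (s • C))
      (-(NormedSpace.exp ((1 - s) • M) * (M * Y - Y * C) * NormedSpace.exp (s • C))) s := by
    intro s
    have h1 : HasDerivAt (fun s : ℝ => NormedSpace.exp ((1 - s) • M))
        (-(NormedSpace.exp ((1 - s) • M) * M)) s := by
      have := (hasDerivAt_exp_smul_const (𝕂 := ℝ) M (1 - s)).scomp s
        ((hasDerivAt_id s).const_sub 1)
      simpa [Function.comp_def] using this
    have h2 := hasDerivAt_exp_smul_const' (𝕂 := ℝ) C s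
    refine ((h1.mul_const Y).mul h2).congr_deriv ?_
    simp only [mul_sub, sub_mul, neg_mul, mul_assoc]
    abel
  have := norm_image_sub_le_of_norm_deriv_le_segment_01'
    (C := Real.exp β * ‖M * Y - Y * C‖ * Real.exp ‖C‖)
    (fun s _ => (hd s).hasDerivWithinAt) (fun s hs => ?_)
  · simpa using this
  · rw [norm_neg]
    refine (norm_mul_le _ _).trans (mul_le_mul ((norm_mul_le _ _).trans ?_) ?_
      (norm_nonneg _) (by positivity))
    · gcongr
      exact norm_exp_smul_le hM hβ hMβ (by linarith [hs.2]) (by linarith [hs.1])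
    · exact norm_exp_smul_le hC (norm_nonneg _) hC.le_algebraMap_norm_self hs.1 hs.2.le

/-- Degenerate perturbation theory for a strong field: if `K ≤ 0` has kernel projection `P`, then
`e^{B + ηK}` converges to `P e^{PBP}` as `η → ∞`. The kernel projection enters through a
pseudo-inverse `G` of `K`. -/
theorem tendsto_exp_add_smul {B K P G : A} (hB : IsSelfAdjoint B) (hP : IsSelfAdjoint P)
    (hK : K ≤ 0) (hKP : K * P = 0) (hPP : P * P = P) (hKG : K * G = 1 - P) :
    Tendsto (fun η : ℝ => NormedSpace.exp (B + η • K)) atTop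
      (𝓝 (P * NormedSpace.exp (P * B * P))) := by
  have hKs : IsSelfAdjoint K := by
    simpa using (IsSelfAdjoint.of_nonneg (neg_nonneg.2 hK)).neg
  have hC : IsSelfAdjoint (P * B * P) := by
    simpa [hP.star_eq] using hB.conjugate P
  set C := P * B * P with hCdef
  have hM : ∀ η : ℝ, IsSelfAdjoint (B + η • K) := fun η =>
    hB.add ((IsSelfAdjoint.all η).smul hKs)
  have hMβ : ∀ η : ℝ, 0 ≤ η → B + η • K ≤ algebraMap ℝ A ‖B‖ := fun η hη => by
    have := smul_nonpos_of_nonneg_of_nonpos hη hK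
    exact (add_le_add hB.le_algebraMap_norm_self this).trans (by simp)
  -- `Y` intertwines `B + ηK` with `C` up to an error of order `1/η`.
  set D := G * B * P * C - B * G * B * P with hD
  have hY : ∀ η : ℝ, 0 < η → (B + η • K) * (P - η⁻¹ • (G * B * P)) -
      (P - η⁻¹ • (G * B * P)) * C = η⁻¹ • D := fun η hη => by
    have h1 : K * (G * B * P) = B * P - P * B * P := by
      rw [← mul_assoc, ← mul_assoc, hKG]; noncomm_ring
    have h2 : P * C = C := by rw [hCdef, ← mul_assoc, ← mul_assoc, hPP]
    rw [add_mul, mul_sub, mul_sub, sub_mul, h2, smul_mul_assoc, smul_mul_assoc, hKP,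
      mul_smul_comm, mul_smul_comm, h1, smul_mul_assoc, smul_comm η, smul_smul,
      inv_mul_cancel₀ hη.ne', one_smul, hD, smul_sub, smul_zero, ← hCdef, ← mul_assoc, ← mul_assoc]
    abel
  have hinv : Tendsto (fun η : ℝ => η⁻¹) atTop (𝓝 0) := tendsto_inv_atTop_zero
  have hYlim : Tendsto (fun η : ℝ => P - η⁻¹ • (G * B * P)) atTop (𝓝 P) := by
    simpa using tendsto_const_nhds.sub (hinv.smul_const (G * B * P))
  have hsmall : Tendsto (fun η : ℝ => (P - η⁻¹ • (G * B * P)) * NormedSpace.exp C -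
      NormedSpace.exp (B + η • K) * (P - η⁻¹ • (G * B * P))) atTop (𝓝 0) := by
    refine squeeze_zero_norm' (a := fun η : ℝ =>
      Real.exp ‖B‖ * (η⁻¹ * ‖D‖) * Real.exp ‖C‖) ?_ ?_
    · filter_upwards [eventually_gt_atTop 0] with η hη
      have := norm_mul_exp_sub_exp_mul_le (Y := P - η⁻¹ • (G * B * P)) (hM η) hC
        (norm_nonneg B) (hMβ η hη.le)
      rwa [hY η hη, norm_smul, norm_inv, Real.norm_of_nonneg hη.le] at this
    · simpa using ((hinv.mul_const ‖D‖).const_mul (Real.exp ‖B‖)).mul_const (Real.exp ‖C‖)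
  have hexp : ∀ η : ℝ, 0 ≤ η → ‖NormedSpace.exp (B + η • K)‖ ≤ Real.exp ‖B‖ := fun η hη => by
    simpa using norm_exp_smul_le (hM η) (norm_nonneg B) (hMβ η hη) zero_le_one le_rfl
  have hlow : Tendsto (fun η : ℝ => NormedSpace.exp (B + η • K) * P) atTop
      (𝓝 (P * NormedSpace.exp C)) := by
    have h3 : Tendsto (fun η : ℝ => η⁻¹ • (NormedSpace.exp (B + η • K) * (G * B * P))) atTop
        (𝓝 0) := by
      refine squeeze_zero_norm' (a := fun η : ℝ => η⁻¹ * (Real.exp ‖B‖ * ‖G * B * P‖)) ?_ ?_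
      · filter_upwards [eventually_gt_atTop 0] with η hη
        rw [norm_smul, norm_inv, Real.norm_of_nonneg hη.le]
        gcongr
        exact (norm_mul_le _ _).trans (by gcongr; exact hexp η hη.le)
      · simpa using hinv.mul_const (Real.exp ‖B‖ * ‖G * B * P‖)
    have := ((hYlim.mul_const (NormedSpace.exp C)).sub hsmall).add h3
    simp only [sub_zero, add_zero] at this
    refine this.congr fun η => ?_
    rw [mul_sub, mul_smul_comm]
    abel
  -- Off the kernel, `e^M K = (e^M M - e^M B)/η`.
  have hhigh : Tendsto (fun η : ℝ => NormedSpace.exp (B + η • K) * (1 - P)) atTop (𝓝 0) := by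
    refine squeeze_zero_norm' (a := fun η : ℝ =>
      η⁻¹ * ((1 + ‖B‖ * Real.exp ‖B‖ + Real.exp ‖B‖ * ‖B‖) * ‖G‖)) ?_ ?_
    · filter_upwards [eventually_gt_atTop 0] with η hη
      have h4 : NormedSpace.exp (B + η • K) * (1 - P) = η⁻¹ •
          ((NormedSpace.exp (B + η • K) * (B + η • K) - NormedSpace.exp (B + η • K) * B) * G) := by
        rw [← mul_sub, add_sub_cancel_left, mul_smul_comm, smul_mul_assoc, smul_smul,
          inv_mul_cancel₀ hη.ne', one_smul, mul_assoc, hKG]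
      rw [h4, norm_smul, norm_inv, Real.norm_of_nonneg hη.le]
      gcongr
      refine (norm_mul_le _ _).trans ?_
      gcongr
      refine (norm_sub_le _ _).trans ?_
      gcongr
      · exact norm_exp_mul_self_le (hM η) (norm_nonneg B) (hMβ η hη.le)
      · exact (norm_mul_le _ _).trans (by gcongr; exact hexp η hη.le)
    · simpa using hinv.mul_const
        ((1 + ‖B‖ * Real.exp ‖B‖ + Real.exp ‖B‖ * ‖B‖) * ‖G‖)
  simpa [← mul_add] using hlow.add hhigh

end CStar

/-! ### Product matrices -/

open scoped Kronecker ComplexOrder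

section ProdMatrix

variable {ι α β γ : Type*} [Fintype ι]

/-- The tensor product `⊗_{x ∈ ι} M_x` of possibly rectangular matrices, with rows and columns
labelled by configurations. -/
def prodMatrix (M : ι → Matrix α β ℂ) : Matrix (ι → α) (ι → β) ℂ :=
  Matrix.of fun σ τ => ∏ x, M x (σ x) (τ x)

theorem prodMatrix_mul [DecidableEq ι] [Fintype β] (M : ι → Matrix α β ℂ)
    (M' : ι → Matrix β γ ℂ) :
    prodMatrix M * prodMatrix M' = prodMatrix (fun x => M x * M' x) := by
  ext σ τ
  simp only [prodMatrix, Matrix.mul_apply, Matrix.of_apply, ← Finset.prod_mul_distrib]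
  rw [Finset.prod_univ_sum, Fintype.piFinset_univ]

theorem prodMatrix_diagonal [DecidableEq α] (v : ι → α → ℂ) :
    prodMatrix (fun x => Matrix.diagonal (v x)) = Matrix.diagonal (fun σ => ∏ x, v x (σ x)) := by
  classical
  ext σ τ
  simp only [prodMatrix, Matrix.of_apply, Matrix.diagonal_apply]
  by_cases h : σ = τ
  · simp [h]
  · obtain ⟨x, hx⟩ := Function.ne_iff.1 h
    rw [if_neg h]
    exact Finset.prod_eq_zero (Finset.mem_univ x) (if_neg hx)

theorem prodMatrix_one [DecidableEq α] :
    prodMatrix (fun _ : ι => (1 : Matrix α α ℂ)) = 1 := by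
  simpa using prodMatrix_diagonal (fun (_ : ι) (_ : α) => (1 : ℂ))

theorem prodMatrix_conjTranspose (M : ι → Matrix α β ℂ) :
    (prodMatrix M).conjTranspose = prodMatrix (fun x => (M x).conjTranspose) := by
  ext σ τ
  simp [prodMatrix, Matrix.conjTranspose_apply]

theorem prodMatrix_update_add [DecidableEq ι] (M : ι → Matrix α β ℂ) (x : ι)
    (m m' : Matrix α β ℂ) :
    prodMatrix (Function.update M x (m + m')) =
      prodMatrix (Function.update M x m) + prodMatrix (Function.update M x m') := by
  ext σ τ
  have h : ∀ m : Matrix α β ℂ, prodMatrix (Function.update M x m) σ τ =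
      m (σ x) (τ x) * ∏ y ∈ Finset.univ.erase x, M y (σ y) (τ y) := by
    intro m
    simp only [prodMatrix, Matrix.of_apply]
    rw [← Finset.mul_prod_erase _ _ (Finset.mem_univ x), Function.update_self]
    congr 1
    refine Finset.prod_congr rfl fun y hy => ?_
    rw [Function.update_of_ne (Finset.ne_of_mem_erase hy)]
  rw [Matrix.add_apply, h, h, h, Matrix.add_apply, add_mul]

theorem prodMatrix_update_smul [DecidableEq ι] (M : ι → Matrix α β ℂ) (x : ι)
    (c : ℂ) (m : Matrix α β ℂ) :
    prodMatrix (Function.update M x (c • m)) = c • prodMatrix (Function.update M x m) := by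
  ext σ τ
  simp only [prodMatrix, Matrix.of_apply, Matrix.smul_apply, smul_eq_mul]
  rw [← Finset.mul_prod_erase _ _ (Finset.mem_univ x),
    ← Finset.mul_prod_erase _ _ (Finset.mem_univ x), Function.update_self, Function.update_self,
    Matrix.smul_apply, smul_eq_mul, mul_assoc]
  congr 2
  refine Finset.prod_congr rfl fun y hy => ?_
  rw [Function.update_of_ne (Finset.ne_of_mem_erase hy),
    Function.update_of_ne (Finset.ne_of_mem_erase hy)]

theorem prodMatrix_nonneg {M : ι → Matrix α β ℂ} (h : ∀ x a b, 0 ≤ M x a b) (σ : ι → α)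
    (τ : ι → β) : 0 ≤ prodMatrix M σ τ :=
  Finset.prod_nonneg fun x _ => h x _ _

end ProdMatrix

theorem tensor_eq_prodMatrix {d : ℕ} {V : Finset (Site d)} (M : V → Matrix (Fin 2) (Fin 2) ℂ) :
    tensor M = prodMatrix M := rfl

/-- The noncommutative product defining `spinProd` is a tensor product. -/
theorem spinProd_eq_tensor {d : ℕ} (V : Finset (Site d)) (i : Fin 2) (A : Finset (Site d)) :
    spinProd V i A = tensor (fun x : V => if (x : Site d) ∈ A then spin i else 1) := by
  have key : ∀ s : Finset V, s.noncommProd (fun x => siteSpin i x)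
      (pairwise_commute_siteSpin i _) = tensor (fun x => if x ∈ s then spin i else 1) := by
    intro s
    induction s using Finset.induction_on with
    | empty =>
      simp only [Finset.noncommProd_empty, Finset.notMem_empty, if_false]
      exact prodMatrix_one.symm
    | insert x s hx ih =>
      rw [Finset.noncommProd_insert_of_notMem _ _ _ _ hx, ih, siteSpin, tensor_mul]
      congr 1
      funext y
      by_cases hy : y = x
      · subst hy; simp [hx]
      · simp [hy]
  rw [spinProd, key]
  simp

theorem siteSpin_eq_spinProd {d : ℕ} {V : Finset (Site d)} (i : Fin 2) (x : V) :
    siteSpin i x = spinProd V i {(x : Site d)} := by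
  rw [spinProd_eq_tensor, siteSpin]
  congr 1
  funext y
  by_cases hy : y = x
  · subst hy; simp
  · have : (y : Site d) ≠ x := fun h => hy (Subtype.ext h)
    simp [hy, this]

theorem spin_conjTranspose (i : Fin 2) : (spin i).conjTranspose = spin i := by
  ext a b
  fin_cases i <;> fin_cases a <;> fin_cases b <;> simp [spin, Matrix.conjTranspose_apply]

theorem spin_mul_self (i : Fin 2) : spin i * spin i = (1 / 4 : ℂ) • 1 := by
  ext a b
  fin_cases i <;> fin_cases a <;> fin_cases b <;>
    simp [spin, Matrix.mul_apply, Fin.sum_univ_two] <;> ring_nf <;> norm_num [Complex.I_sq]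

theorem isHermitian_spinProd {d : ℕ} (V : Finset (Site d)) (i : Fin 2) (A : Finset (Site d)) :
    (spinProd V i A).IsHermitian := by
  rw [Matrix.IsHermitian, spinProd_eq_tensor, tensor_eq_prodMatrix, prodMatrix_conjTranspose]
  congr 1
  funext x
  split_ifs
  · exact spin_conjTranspose i
  · simp

/-! ### Doubled systems and the correlation inequality -/

section Positivity

variable {n : Type*} [Fintype n]

theorem exp_apply_nonneg [DecidableEq n] {X : Matrix n n ℂ} (hX : ∀ i j, 0 ≤ X i j) (i j : n) :
    0 ≤ NormedSpace.exp X i j := by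
  have hpow : ∀ (k : ℕ) (i j : n), 0 ≤ (X ^ k) i j := by
    intro k
    induction k with
    | zero => intro i j; rw [pow_zero, Matrix.one_apply]; split_ifs <;> simp
    | succ k ih =>
      intro i j
      rw [pow_succ, Matrix.mul_apply]
      exact Finset.sum_nonneg fun l _ => mul_nonneg (ih i l) (hX l j)
  have hs : HasSum (fun k : ℕ => ((k.factorial : ℂ)⁻¹ • X ^ k)) (NormedSpace.exp X) := by
    open scoped Matrix.Norms.Operator in
    exact NormedSpace.exp_series_hasSum_exp' (𝕂 := ℂ) X
  have hs' : HasSum (fun k : ℕ => ((k.factorial : ℂ)⁻¹ • X ^ k) i j) (NormedSpace.exp X i j) :=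
    Pi.hasSum.1 (Pi.hasSum.1 hs i) j
  have := Complex.orderClosedTopology
  refine hs'.nonneg fun k => ?_
  rw [Matrix.smul_apply, smul_eq_mul]
  exact mul_nonneg (by positivity) (hpow k i j)

/-- `X` has nonnegative entries in the basis given by the columns of `W`, where `W'` is the inverse
of `W`. -/
def EntrywiseNonneg (W W' X : Matrix n n ℂ) : Prop :=
  ∀ i j, 0 ≤ (W' * X * W) i j

namespace EntrywiseNonneg

variable {W W' X Y : Matrix n n ℂ}

theorem zero : EntrywiseNonneg W W' 0 := fun i j => by simp

theorem one [DecidableEq n] (h : W' * W = 1) : EntrywiseNonneg W W' 1 := fun i j => by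
  rw [mul_one, h, Matrix.one_apply]; split_ifs <;> simp

theorem add (hX : EntrywiseNonneg W W' X) (hY : EntrywiseNonneg W W' Y) :
    EntrywiseNonneg W W' (X + Y) := fun i j => by
  rw [mul_add, add_mul]
  exact add_nonneg (hX i j) (hY i j)

theorem smul {c : ℂ} (hc : 0 ≤ c) (hX : EntrywiseNonneg W W' X) :
    EntrywiseNonneg W W' (c • X) := fun i j => by
  rw [Matrix.mul_smul, Matrix.smul_mul]
  exact mul_nonneg hc (hX i j)

theorem sum {κ : Type*} {s : Finset κ} {f : κ → Matrix n n ℂ}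
    (h : ∀ k ∈ s, EntrywiseNonneg W W' (f k)) : EntrywiseNonneg W W' (∑ k ∈ s, f k) :=
  Finset.sum_induction f (EntrywiseNonneg W W') (fun _ _ => add) zero h

theorem mul [DecidableEq n] (h : W' * W = 1) (hX : EntrywiseNonneg W W' X)
    (hY : EntrywiseNonneg W W' Y) :
    EntrywiseNonneg W W' (X * Y) := fun i j => by
  have h' : W * W' = 1 := mul_eq_one_comm.1 h
  have : W' * (X * Y) * W = (W' * X * W) * (W' * Y * W) := by
    calc W' * (X * Y) * W = W' * X * 1 * Y * W := by simp [mul_assoc]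
      _ = _ := by rw [← h']; simp only [mul_assoc]
  rw [this, Matrix.mul_apply]
  exact Finset.sum_nonneg fun l _ => mul_nonneg (hX i l) (hY l j)

theorem exp [DecidableEq n] (h : W' * W = 1) (hX : EntrywiseNonneg W W' X) :
    EntrywiseNonneg W W' (NormedSpace.exp X) := by
  have h' : W * W' = 1 := mul_eq_one_comm.1 h
  have := Matrix.exp_units_conj ⟨W', W, h, h'⟩ X
  intro i j
  simp only [Units.inv_mk] at this
  rw [← this]
  exact exp_apply_nonneg hX i j

theorem trace_nonneg [DecidableEq n] (h : W' * W = 1) (hX : EntrywiseNonneg W W' X) :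
    0 ≤ X.trace := by
  have h' : W * W' = 1 := mul_eq_one_comm.1 h
  have : X.trace = (W' * X * W).trace := by
    rw [Matrix.trace_mul_cycle, h', one_mul]
  rw [this]
  exact Finset.sum_nonneg fun i _ => hX i i

end EntrywiseNonneg

end Positivity

section Doubling

/-- The operator `a ⊗ b` on the doubled system, as a matrix in the product basis whose elements
label each site by a pair of spins, one for each copy. -/
def double {d : ℕ} {V : Finset (Site d)} (a b : Op V) :
    Matrix (V → Fin 2 × Fin 2) (V → Fin 2 × Fin 2) ℂ :=
  (a ⊗ₖ b).submatrix (Equiv.arrowProdEquivProdArrow V (fun _ => Fin 2) fun _ => Fin 2)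
    (Equiv.arrowProdEquivProdArrow V (fun _ => Fin 2) fun _ => Fin 2)

variable {d : ℕ} {V : Finset (Site d)}

theorem double_mul (a b a' b' : Op V) : double (a * a') (b * b') = double a b * double a' b' := by
  rw [double, double, double, Matrix.submatrix_mul_equiv, Matrix.mul_kronecker_mul]

theorem double_one : double (1 : Op V) 1 = 1 := by
  rw [double, Matrix.one_kronecker_one, Matrix.submatrix_one_equiv]

theorem double_add_left (a a' b : Op V) : double (a + a') b = double a b + double a' b := by
  rw [double, Matrix.add_kronecker]; rfl

theorem double_add_right (a b b' : Op V) : double a (b + b') = double a b + double a b' := by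
  rw [double, Matrix.kronecker_add]; rfl

theorem double_smul_left (c : ℂ) (a b : Op V) : double (c • a) b = c • double a b := by
  rw [double, Matrix.smul_kronecker]; rfl

theorem double_smul_right (c : ℂ) (a b : Op V) : double a (c • b) = c • double a b := by
  rw [double, Matrix.kronecker_smul]; rfl

theorem trace_double (a b : Op V) : (double a b).trace = a.trace * b.trace := by
  rw [← Matrix.trace_kronecker]
  exact Equiv.sum_comp (Equiv.arrowProdEquivProdArrow V (fun _ => Fin 2) fun _ => Fin 2)
    (fun p => (a ⊗ₖ b) p p)

theorem double_tensor (M M' : V → Matrix (Fin 2) (Fin 2) ℂ) :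
    double (tensor M) (tensor M') = prodMatrix (fun x => M x ⊗ₖ M' x) := by
  ext σ τ
  simp [double, tensor, prodMatrix, Matrix.kroneckerMap_apply, Finset.prod_mul_distrib,
    Equiv.arrowProdEquivProdArrow]

/-- The embedding `a ↦ a ⊗ 1` into the doubled system. -/
def doubleLeft (V : Finset (Site d)) :
    Op V →ₐ[ℂ] Matrix (V → Fin 2 × Fin 2) (V → Fin 2 × Fin 2) ℂ :=
  AlgHom.ofLinearMap
    { toFun := fun a => double a 1
      map_add' := fun a a' => double_add_left a a' 1
      map_smul' := fun c a => double_smul_left c a 1 } double_one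
    (fun a a' => by simp [← double_mul])

/-- The embedding `a ↦ 1 ⊗ a` into the doubled system. -/
def doubleRight (V : Finset (Site d)) :
    Op V →ₐ[ℂ] Matrix (V → Fin 2 × Fin 2) (V → Fin 2 × Fin 2) ℂ :=
  AlgHom.ofLinearMap
    { toFun := fun a => double 1 a
      map_add' := fun a a' => double_add_right 1 a a'
      map_smul' := fun c a => double_smul_right c 1 a } double_one
    (fun a a' => by simp [← double_mul])

theorem doubleLeft_mul_doubleRight (a b : Op V) :
    doubleLeft V a * doubleRight V b = double a b := by
  change double a 1 * double 1 b = _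
  rw [← double_mul, mul_one, one_mul]

theorem doubleRight_mul_doubleLeft (a b : Op V) :
    doubleRight V b * doubleLeft V a = double a b := by
  change double 1 b * double a 1 = _
  rw [← double_mul, mul_one, one_mul]

theorem algHom_exp {n m : Type*} [Fintype n] [Fintype m] [DecidableEq n] [DecidableEq m]
    (f : Matrix n n ℂ →ₐ[ℂ] Matrix m m ℂ) (a : Matrix n n ℂ) :
    f (NormedSpace.exp a) = NormedSpace.exp (f a) := by
  open scoped Matrix.Norms.Operator in
  exact NormedSpace.map_exp f (LinearMap.continuous_of_finiteDimensional f.toLinearMap) a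

theorem exp_doubleLeft_add_doubleRight (h h' : Op V) :
    NormedSpace.exp (doubleLeft V h + doubleRight V h') =
      double (NormedSpace.exp h) (NormedSpace.exp h') := by
  rw [Matrix.exp_add_of_commute, ← algHom_exp, ← algHom_exp, doubleLeft_mul_doubleRight]
  exact (doubleLeft_mul_doubleRight h h').trans (doubleRight_mul_doubleLeft h h').symm

/-- The basis of `ℂ² ⊗ ℂ²` (unnormalized) with columns `|00⟩ + |11⟩`, `|01⟩ + |10⟩`,
`-i(|00⟩ - |11⟩)` and `i(|01⟩ - |10⟩)`, labelled by `(0,0)`, `(0,1)`, `(1,0)` and `(1,1)`. -/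
def siteBasis : Matrix (Fin 2 × Fin 2) (Fin 2 × Fin 2) ℂ :=
  Matrix.of fun a ν => if a.1 + a.2 = ν.2 then
    (if ν.1 = 0 then 1 else if a.2 = 0 then -Complex.I else Complex.I) else 0

/-- The inverse of `siteBasis`. -/
def siteBasisInv : Matrix (Fin 2 × Fin 2) (Fin 2 × Fin 2) ℂ :=
  (1 / 2 : ℂ) • siteBasis.conjTranspose

theorem siteBasisInv_mul_siteBasis : siteBasisInv * siteBasis = 1 := by
  ext ⟨a, b⟩ ⟨c, e⟩
  fin_cases a <;> fin_cases b <;> fin_cases c <;> fin_cases e <;>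
    norm_num [siteBasisInv, siteBasis, Matrix.mul_apply, Fintype.sum_prod_type, Fin.sum_univ_two,
      Matrix.one_apply, Matrix.conjTranspose_apply, show (1 + 1 : Fin 2) = 0 from rfl, mul_assoc]

/-- `S^i ⊗ 1 + 1 ⊗ S^i` has nonnegative matrix elements in the basis `siteBasis`. -/
theorem siteBasis_spin_add (i : Fin 2) (a b : Fin 2 × Fin 2) :
    0 ≤ (siteBasisInv * (spin i ⊗ₖ (1 : Matrix (Fin 2) (Fin 2) ℂ) +
      (1 : Matrix (Fin 2) (Fin 2) ℂ) ⊗ₖ spin i) * siteBasis) a b := by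
  obtain ⟨a, a'⟩ := a
  obtain ⟨b, b'⟩ := b
  fin_cases i <;> fin_cases a <;> fin_cases a' <;> fin_cases b <;> fin_cases b' <;>
    norm_num [siteBasisInv, siteBasis, Matrix.mul_apply, Fintype.sum_prod_type, Fin.sum_univ_two,
      Matrix.one_apply, Matrix.conjTranspose_apply, spin, Matrix.kroneckerMap_apply,
      show (1 + 1 : Fin 2) = 0 from rfl, mul_assoc] <;>
    norm_num [Complex.le_def]

/-- In the basis `siteBasis`, `S^i ⊗ 1 - 1 ⊗ S^i` has nonnegative matrix elements for `S¹` and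
nonpositive ones for `S²`. The exponent is the index of the spin component, which starts at `0`. -/
theorem siteBasis_spin_sub (i : Fin 2) (a b : Fin 2 × Fin 2) :
    0 ≤ (siteBasisInv * (((-1 : ℂ) ^ (i : ℕ)) • (spin i ⊗ₖ (1 : Matrix (Fin 2) (Fin 2) ℂ) -
      (1 : Matrix (Fin 2) (Fin 2) ℂ) ⊗ₖ spin i)) * siteBasis) a b := by
  obtain ⟨a, a'⟩ := a
  obtain ⟨b, b'⟩ := b
  fin_cases i <;> fin_cases a <;> fin_cases a' <;> fin_cases b <;> fin_cases b' <;>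
    norm_num [siteBasisInv, siteBasis, Matrix.mul_apply, Fintype.sum_prod_type, Fin.sum_univ_two,
      Matrix.one_apply, Matrix.conjTranspose_apply, spin, Matrix.kroneckerMap_apply,
      show (1 + 1 : Fin 2) = 0 from rfl, mul_assoc] <;>
    norm_num [Complex.le_def]

end Doubling

section Correlation

variable {d : ℕ} {V : Finset (Site d)}

theorem doubleLeft_siteSpin (i : Fin 2) (x : V) : doubleLeft V (siteSpin i x) =
    prodMatrix (Function.update (fun _ => 1) x (spin i ⊗ₖ (1 : Matrix (Fin 2) (Fin 2) ℂ))) := by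
  change double (siteSpin i x) 1 = _
  rw [siteSpin, ← prodMatrix_one, ← tensor_eq_prodMatrix, double_tensor]
  congr 1
  funext y
  by_cases h : y = x
  · subst h; simp
  · simp [h]

theorem doubleRight_siteSpin (i : Fin 2) (x : V) : doubleRight V (siteSpin i x) =
    prodMatrix (Function.update (fun _ => 1) x ((1 : Matrix (Fin 2) (Fin 2) ℂ) ⊗ₖ spin i)) := by
  change double 1 (siteSpin i x) = _
  rw [siteSpin, ← prodMatrix_one, ← tensor_eq_prodMatrix, double_tensor]
  congr 1
  funext y
  by_cases h : y = x
  · subst h; simp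
  · simp [h]

/-- The cone of operators on the doubled system that have nonnegative matrix elements in the
product of the bases `siteBasis`. -/
def DoublePos (V : Finset (Site d)) :
    Matrix (V → Fin 2 × Fin 2) (V → Fin 2 × Fin 2) ℂ → Prop :=
  EntrywiseNonneg (prodMatrix fun _ => siteBasis) (prodMatrix fun _ => siteBasisInv)

theorem prod_siteBasisInv_mul :
    (prodMatrix fun _ : V => siteBasisInv) * (prodMatrix fun _ : V => siteBasis) = 1 := by
  rw [prodMatrix_mul, siteBasisInv_mul_siteBasis, prodMatrix_one]

theorem doublePos_update {x : V} {m : Matrix (Fin 2 × Fin 2) (Fin 2 × Fin 2) ℂ}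
    (hm : ∀ a b, 0 ≤ (siteBasisInv * m * siteBasis) a b) :
    DoublePos V (prodMatrix (Function.update (fun _ => 1) x m)) := by
  intro σ τ
  rw [prodMatrix_mul, prodMatrix_mul]
  refine prodMatrix_nonneg (fun y a b => ?_) σ τ
  by_cases h : y = x
  · subst h; simpa using hm a b
  · rw [Function.update_of_ne h, mul_one, siteBasisInv_mul_siteBasis, Matrix.one_apply]
    split_ifs <;> simp

/-- `a` is Ginibre-positive with sign `ε` if `a ⊗ 1 + 1 ⊗ a` and `ε (a ⊗ 1 - 1 ⊗ a)` both belong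
to the cone `DoublePos`. -/
def GinibrePos (ε : ℂ) (a : Op V) : Prop :=
  DoublePos V (doubleLeft V a + doubleRight V a) ∧
    DoublePos V (ε • (doubleLeft V a - doubleRight V a))

theorem ginibrePos_one (ε : ℂ) : GinibrePos ε (1 : Op V) := by
  constructor
  · rw [map_one, map_one]
    exact .add (.one prod_siteBasisInv_mul) (.one prod_siteBasisInv_mul)
  · rw [map_one, map_one, sub_self, smul_zero]
    exact .zero

/-- `ab ⊗ 1 ± 1 ⊗ ab` is a combination with coefficients `1/2` of products of the sums and
differences for `a` and for `b`. -/
theorem GinibrePos.mul {ε : ℂ} (hε : ε * ε = 1) {a b : Op V} (ha : GinibrePos ε a)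
    (hb : GinibrePos ε b) : GinibrePos ε (a * b) := by
  have hmul {X Y} (hX : DoublePos V X) (hY : DoublePos V Y) : DoublePos V (X * Y) :=
    EntrywiseNonneg.mul prod_siteBasisInv_mul hX hY
  constructor
  · have h : doubleLeft V (a * b) + doubleRight V (a * b) = (1 / 2 : ℂ) •
        ((doubleLeft V a + doubleRight V a) * (doubleLeft V b + doubleRight V b) +
          (ε • (doubleLeft V a - doubleRight V a)) * (ε • (doubleLeft V b - doubleRight V b))) := by
      rw [smul_mul_smul_comm, hε, one_smul, map_mul, map_mul]
      have : ∀ p q r s : Matrix (V → Fin 2 × Fin 2) (V → Fin 2 × Fin 2) ℂ,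
          (p + q) * (r + s) + (p - q) * (r - s) = (2 : ℂ) • (p * r + q * s) := by
        intro p q r s; rw [two_smul]; noncomm_ring
      rw [this, smul_smul]; norm_num
    rw [h]
    exact .smul (by positivity) (.add (hmul ha.1 hb.1) (hmul ha.2 hb.2))
  · have h : ε • (doubleLeft V (a * b) - doubleRight V (a * b)) = (1 / 2 : ℂ) •
        ((doubleLeft V a + doubleRight V a) * (ε • (doubleLeft V b - doubleRight V b)) +
          (ε • (doubleLeft V a - doubleRight V a)) * (doubleLeft V b + doubleRight V b)) := by
      rw [mul_smul_comm, smul_mul_assoc, ← smul_add, smul_comm, map_mul, map_mul]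
      congr 1
      have : ∀ p q r s : Matrix (V → Fin 2 × Fin 2) (V → Fin 2 × Fin 2) ℂ,
          (p + q) * (r - s) + (p - q) * (r + s) = (2 : ℂ) • (p * r - q * s) := by
        intro p q r s; rw [two_smul]; noncomm_ring
      rw [this, smul_smul]; norm_num
    rw [h]
    exact .smul (by positivity) (.add (hmul ha.1 hb.2) (hmul ha.2 hb.1))

theorem ginibrePos_siteSpin (i : Fin 2) (x : V) :
    GinibrePos ((-1) ^ (i : ℕ)) (siteSpin i x) := by
  constructor
  · rw [doubleLeft_siteSpin, doubleRight_siteSpin, ← prodMatrix_update_add]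
    exact doublePos_update (siteBasis_spin_add i)
  · have h : ∀ p q : Matrix (Fin 2 × Fin 2) (Fin 2 × Fin 2) ℂ,
        prodMatrix (Function.update (fun _ : V => 1) x p) -
          prodMatrix (Function.update (fun _ : V => 1) x q) =
        prodMatrix (Function.update (fun _ : V => 1) x (p - q)) := fun p q => by
      rw [sub_eq_iff_eq_add, ← prodMatrix_update_add, sub_add_cancel]
    rw [doubleLeft_siteSpin, doubleRight_siteSpin, h, ← prodMatrix_update_smul]
    exact doublePos_update (siteBasis_spin_sub i)

theorem ginibrePos_spinProd (i : Fin 2) (A : Finset (Site d)) :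
    GinibrePos ((-1) ^ (i : ℕ)) (spinProd V i A) := by
  have hε : ((-1 : ℂ) ^ (i : ℕ)) * (-1) ^ (i : ℕ) = 1 := by
    rw [← mul_pow]; norm_num
  refine Finset.noncommProd_induction _ _ _ (GinibrePos ((-1) ^ (i : ℕ)))
    (fun _ _ ha hb => ha.mul hε hb) (ginibrePos_one _) (fun x _ => ginibrePos_siteSpin i x)

theorem GinibrePos.doubleLeft {a : Op V} (ha : GinibrePos 1 a) :
    DoublePos V (doubleLeft V a) := by
  have h : QuantumXY.doubleLeft V a = (1 / 2 : ℂ) •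
      ((QuantumXY.doubleLeft V a + doubleRight V a) +
        (1 : ℂ) • (QuantumXY.doubleLeft V a - doubleRight V a)) := by
    rw [one_smul, add_add_sub_cancel, ← two_smul ℂ, smul_smul]; norm_num
  rw [h]
  exact .smul (by positivity) (.add ha.1 ha.2)

/-- Ginibre's inequality, comparing two Hamiltonians rather than differentiating with respect to
a coupling: the difference of the two expectations of `a` is a trace over the doubled system of
a product of operators in the cone. -/
theorem ginibre_inequality {h h' a : Op V}
    (hh : DoublePos V (doubleLeft V h + doubleRight V h'))
    (ha : DoublePos V (doubleLeft V a - doubleRight V a)) :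
    (NormedSpace.exp h).trace * (a * NormedSpace.exp h').trace ≤
      (a * NormedSpace.exp h).trace * (NormedSpace.exp h').trace := by
  have key := EntrywiseNonneg.trace_nonneg prod_siteBasisInv_mul
    (EntrywiseNonneg.mul prod_siteBasisInv_mul ha (EntrywiseNonneg.exp prod_siteBasisInv_mul hh))
  have e : (doubleLeft V a - doubleRight V a) *
      NormedSpace.exp (doubleLeft V h + doubleRight V h') =
      double (a * NormedSpace.exp h) (NormedSpace.exp h') -
        double (NormedSpace.exp h) (a * NormedSpace.exp h') := by
    rw [exp_doubleLeft_add_doubleRight, sub_mul]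
    change double a 1 * _ - double 1 a * _ = _
    rw [← double_mul, ← double_mul, one_mul, one_mul]
  rw [e, Matrix.trace_sub, trace_double, trace_double] at key
  exact sub_nonneg.1 key

end Correlation

/-! ### Gibbs expectations -/

section Gibbs

variable {n : Type*} [Fintype n] [DecidableEq n]

/-- The Gibbs expectation `Tr (a e^h) / Tr e^h`, for the Hamiltonian `-h`. -/
def gibbs (h a : Matrix n n ℂ) : ℂ :=
  (a * NormedSpace.exp h).trace / (NormedSpace.exp h).trace

/-- The exponential of a Hermitian matrix is a square, namely that of `e^{h/2}`. -/
theorem exists_exp_eq_mul_self {h : Matrix n n ℂ} (hh : h.IsHermitian) :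
    ∃ X : Matrix n n ℂ, X.IsHermitian ∧ IsUnit X ∧ NormedSpace.exp h = X * X := by
  have hX : ((1 / 2 : ℂ) • h).IsHermitian := by
    rw [Matrix.IsHermitian, Matrix.conjTranspose_smul, hh.eq]
    norm_num
  refine ⟨NormedSpace.exp ((1 / 2 : ℂ) • h), hX.exp, Matrix.isUnit_exp _, ?_⟩
  rw [← Matrix.exp_add_of_commute _ _ (Commute.refl _), ← add_smul]
  norm_num

theorem trace_exp_pos [Nonempty n] {h : Matrix n n ℂ} (hh : h.IsHermitian) :
    0 < (NormedSpace.exp h).trace := by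
  obtain ⟨X, hX, hu, he⟩ := exists_exp_eq_mul_self hh
  rw [he]
  have : (X * X).PosDef := by
    conv => arg 1; arg 1; rw [← hX.eq]
    exact (Matrix.PosDef.conjTranspose_mul_self X (Matrix.mulVec_injective_of_isUnit hu))
  exact this.trace_pos

theorem gibbs_add_smul_one (h a : Matrix n n ℂ) (c : ℂ) : gibbs (h + c • 1) a = gibbs h a := by
  have e : NormedSpace.exp (h + c • (1 : Matrix n n ℂ)) = Complex.exp c • NormedSpace.exp h := by
    have h1 : NormedSpace.exp (c • (1 : Matrix n n ℂ)) = Complex.exp c • 1 := by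
      rw [← Algebra.algebraMap_eq_smul_one, ← Algebra.algebraMap_eq_smul_one,
        Complex.exp_eq_exp_ℂ]
      open scoped Matrix.Norms.Operator in
      exact (NormedSpace.algebraMap_exp_comm c).symm
    rw [Matrix.exp_add_of_commute _ _ ((Commute.one_right h).smul_right c), h1, mul_smul_comm,
      mul_one]
  rw [gibbs, gibbs, e, mul_smul_comm, Matrix.trace_smul, Matrix.trace_smul, smul_eq_mul,
    smul_eq_mul, mul_div_mul_left _ _ (Complex.exp_ne_zero c)]

theorem gibbs_smul (h a : Matrix n n ℂ) (c : ℂ) : gibbs h (c • a) = c * gibbs h a := by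
  rw [gibbs, gibbs, smul_mul_assoc, Matrix.trace_smul, smul_eq_mul, mul_div_assoc]

theorem gibbs_neg (h a : Matrix n n ℂ) : gibbs h (-a) = -gibbs h a := by
  rw [gibbs, gibbs, neg_mul, Matrix.trace_neg, neg_div]

/-- The bound follows from `⟨(1 - a)²⟩ ≥ 0`. -/
theorem gibbs_le_one [Nonempty n] {h a : Matrix n n ℂ} (hh : h.IsHermitian) (ha : a.IsHermitian)
    {r : ℂ} (hr : r ≤ 1) (har : a * a = r • 1) : gibbs h a ≤ 1 := by
  have hT := trace_exp_pos hh
  obtain ⟨X, hX, -, he⟩ := exists_exp_eq_mul_self hh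
  have h1 : 0 ≤ ((1 - a) * (1 - a) * NormedSpace.exp h).trace := by
    have h2 : ((X * (1 - a)) * (X * (1 - a)).conjTranspose).trace =
        ((1 - a) * (1 - a) * NormedSpace.exp h).trace := by
      rw [Matrix.conjTranspose_mul, Matrix.conjTranspose_sub, ha.eq, hX.eq,
        Matrix.conjTranspose_one, he, mul_assoc, Matrix.trace_mul_comm, ← mul_assoc, ← mul_assoc]
    rw [← h2]
    exact (Matrix.posSemidef_self_mul_conjTranspose _).trace_nonneg
  have h3 : (1 - a) * (1 - a) = (1 + r) • 1 - (2 : ℂ) • a := by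
    rw [sub_mul, mul_sub, mul_sub, har, add_smul, one_smul, two_smul]
    simp only [one_mul, mul_one]; abel
  rw [h3, sub_mul, smul_mul_assoc, smul_mul_assoc, one_mul, Matrix.trace_sub, Matrix.trace_smul,
    Matrix.trace_smul, smul_eq_mul, smul_eq_mul, sub_nonneg] at h1
  rw [gibbs, div_le_one₀ hT]
  have h4 : (1 + r) * (NormedSpace.exp h).trace ≤ 2 * (NormedSpace.exp h).trace :=
    mul_le_mul_of_nonneg_right (by
      calc 1 + r ≤ 1 + 1 := by gcongr
        _ = 2 := by norm_num) hT.le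
  exact le_of_mul_le_mul_left (h1.trans h4) (by norm_num)

/-- On the range of a projection `P` commuting with `X`, the exponentials of `PX` and `X`
agree. -/
theorem mul_exp_mul {P X : Matrix n n ℂ} (hPP : P * P = P) (hPX : Commute P X) :
    P * NormedSpace.exp (P * X) = P * NormedSpace.exp X := by
  have hpow : ∀ k : ℕ, P * (P * X) ^ k = P * X ^ k := by
    intro k
    rw [hPX.mul_pow, ← mul_assoc, ← pow_succ']
    congr 1
    exact (show IsIdempotentElem P from hPP).pow_succ_eq k
  have hs : ∀ Y : Matrix n n ℂ, HasSum (fun k : ℕ => P * ((k.factorial : ℂ)⁻¹ • Y ^ k))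
      (P * NormedSpace.exp Y) := fun Y => by
    open scoped Matrix.Norms.Operator in
    exact (NormedSpace.exp_series_hasSum_exp' (𝕂 := ℂ) Y).mul_left P
  refine (hs (P * X)).unique ?_
  convert hs X using 2 with k
  rw [mul_smul_comm, mul_smul_comm, hpow]

end Gibbs

/-! ### Infinite fields outside `Λ` -/

section Boundary

variable {d : ℕ} {Λ V : Finset (Site d)}

/-- Configurations on `V` as pairs of a configuration on `Λ ⊆ V` and one on `V ∖ Λ`. -/
def splitEquiv (h : Λ ⊆ V) :
    (V → Fin 2) ≃ (Λ → Fin 2) × ({x : V // (x : Site d) ∉ Λ} → Fin 2) where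
  toFun σ := (fun x => σ ⟨x, h x.2⟩, fun x => σ x)
  invFun p x := if hx : (x : Site d) ∈ Λ then p.1 ⟨x, hx⟩ else p.2 ⟨x, hx⟩
  left_inv σ := by
    funext x
    by_cases hx : (x : Site d) ∈ Λ <;> simp [hx]
  right_inv p := by
    refine Prod.ext (funext fun x => ?_) (funext fun x => ?_)
    · simp
    · simp [x.2]

/-- The operator `a ⊗ c` on `⊗_{x ∈ V} ℂ²`, for `a` acting on `Λ ⊆ V` and `c` on `V ∖ Λ`. -/
def splitProd (h : Λ ⊆ V) (a : Op Λ)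
    (c : Matrix ({x : V // (x : Site d) ∉ Λ} → Fin 2) ({x : V // (x : Site d) ∉ Λ} → Fin 2) ℂ) :
    Op V :=
  (a ⊗ₖ c).submatrix (splitEquiv h) (splitEquiv h)

theorem splitProd_mul (h : Λ ⊆ V) (a a' : Op Λ) (c c') :
    splitProd h a c * splitProd h a' c' = splitProd h (a * a') (c * c') := by
  rw [splitProd, splitProd, splitProd, Matrix.submatrix_mul_equiv, Matrix.mul_kronecker_mul]

theorem trace_splitProd (h : Λ ⊆ V) (a : Op Λ) (c) :
    (splitProd h a c).trace = a.trace * c.trace := by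
  rw [← Matrix.trace_kronecker]
  exact Equiv.sum_comp (splitEquiv h) (fun p => (a ⊗ₖ c) p p)

theorem splitProd_smul_left (h : Λ ⊆ V) (z : ℂ) (a : Op Λ) (c) :
    splitProd h (z • a) c = z • splitProd h a c := by
  rw [splitProd, Matrix.smul_kronecker]; rfl

theorem splitProd_smul_right (h : Λ ⊆ V) (z : ℂ) (a : Op Λ) (c) :
    splitProd h a (z • c) = z • splitProd h a c := by
  rw [splitProd, Matrix.kronecker_smul]; rfl

theorem splitProd_add_left (h : Λ ⊆ V) (a a' : Op Λ) (c) :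
    splitProd h (a + a') c = splitProd h a c + splitProd h a' c := by
  rw [splitProd, Matrix.add_kronecker]; rfl

/-- A tensor product over `V` factorizes into its parts over `Λ` and `V ∖ Λ`. -/
theorem tensor_eq_splitProd (h : Λ ⊆ V) (M : V → Matrix (Fin 2) (Fin 2) ℂ) :
    tensor M = splitProd h (tensor fun x : Λ => M ⟨x, h x.2⟩)
      (prodMatrix fun x : {x : V // (x : Site d) ∉ Λ} => M x) := by
  ext σ τ
  simp only [tensor, splitProd, prodMatrix, Matrix.of_apply, Matrix.submatrix_apply,
    Matrix.kroneckerMap_apply, splitEquiv, Equiv.coe_fn_mk]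
  rw [← Fintype.prod_subtype_mul_prod_subtype (fun x : V => (x : Site d) ∈ Λ)]
  congr 1
  exact Fintype.prod_equiv
    { toFun := fun x => ⟨x.1, x.2⟩
      invFun := fun x => ⟨⟨x, h x.2⟩, x.2⟩
      left_inv := fun _ => rfl
      right_inv := fun _ => rfl } _ _ fun x => rfl

theorem extend_eq_splitProd (h : Λ ⊆ V) (a : Op Λ) : extend h a = splitProd h a 1 := by
  ext σ τ
  simp only [extend, splitProd, Matrix.of_apply, Matrix.submatrix_apply,
    Matrix.kroneckerMap_apply, splitEquiv, Equiv.coe_fn_mk, Matrix.one_apply, funext_iff,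
    Subtype.forall]

/-- The embedding `a ↦ a ⊗ 1` as a homomorphism of algebras. -/
def extendHom (h : Λ ⊆ V) : Op Λ →ₐ[ℂ] Op V :=
  AlgHom.ofLinearMap
    { toFun := extend h
      map_add' := fun a a' => by simp only [extend_eq_splitProd, splitProd_add_left]
      map_smul' := fun c a => by simp only [extend_eq_splitProd, splitProd_smul_left]; rfl }
    (by
      change extend h 1 = 1
      rw [extend_eq_splitProd, splitProd, Matrix.one_kronecker_one, Matrix.submatrix_one_equiv])
    (fun a a' => by
      change extend h (a * a') = extend h a * extend h a'
      rw [extend_eq_splitProd, extend_eq_splitProd, extend_eq_splitProd, splitProd_mul, one_mul])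

theorem extend_spinProd (h : Λ ⊆ V) (i : Fin 2) {A : Finset (Site d)} (hA : A ⊆ Λ) :
    extend h (spinProd Λ i A) = spinProd V i A := by
  rw [extend_eq_splitProd, spinProd_eq_tensor, spinProd_eq_tensor, tensor_eq_splitProd h,
    ← prodMatrix_one]
  congr 2
  funext x
  rw [if_neg fun hx => x.2 (hA hx)]

/-- The projection onto the spin state with `S¹ = 1/2`. -/
def plusSite : Matrix (Fin 2) (Fin 2) ℂ := (1 / 2 : ℂ) • !![1, 1; 1, 1]

/-- The expectation of `S^i` in the spin state with `S¹ = 1/2`. -/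
def plusValue : Fin 2 → ℝ := ![1 / 2, 0]

theorem plusSite_mul_self : plusSite * plusSite = plusSite := by
  ext a b
  fin_cases a <;> fin_cases b <;> norm_num [plusSite, Matrix.mul_apply, Fin.sum_univ_two]

theorem plusSite_mul_spin_mul (i : Fin 2) :
    plusSite * spin i * plusSite = (plusValue i : ℂ) • plusSite := by
  ext a b
  fin_cases i <;> fin_cases a <;> fin_cases b <;>
    norm_num [plusSite, spin, plusValue, Matrix.mul_apply, Fin.sum_univ_two]

theorem plusSite_conjTranspose : plusSite.conjTranspose = plusSite := by
  ext a b
  fin_cases a <;> fin_cases b <;> simp [plusSite, Matrix.conjTranspose_apply]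

/-- The projection onto the states with `S¹_x = 1/2` for all `x ∈ V ∖ Λ`. -/
def plusProj (Λ V : Finset (Site d)) : Op V :=
  tensor fun x : V => if (x : Site d) ∈ Λ then 1 else plusSite

theorem plusProj_mul_self : plusProj Λ V * plusProj Λ V = plusProj Λ V := by
  rw [plusProj, tensor_mul]
  congr 1; funext x
  split_ifs
  · simp
  · exact plusSite_mul_self

theorem isHermitian_plusProj : (plusProj Λ V).IsHermitian := by
  rw [Matrix.IsHermitian, plusProj, tensor_eq_prodMatrix, prodMatrix_conjTranspose]
  congr 1; funext x
  split_ifs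
  · simp
  · exact plusSite_conjTranspose

theorem plusProj_eq_splitProd (h : Λ ⊆ V) :
    plusProj Λ V = splitProd h 1 (prodMatrix fun _ => plusSite) := by
  rw [plusProj, tensor_eq_splitProd h]
  congr 1
  · simp [tensor_eq_prodMatrix, prodMatrix_one]
  · congr 1; funext x; rw [if_neg x.2]

theorem plusProj_mul_extend (h : Λ ⊆ V) (a : Op Λ) :
    plusProj Λ V * extend h a = splitProd h a (prodMatrix fun _ => plusSite) := by
  rw [plusProj_eq_splitProd h, extend_eq_splitProd, splitProd_mul, one_mul, mul_one]

theorem commute_plusProj_extend (h : Λ ⊆ V) (a : Op Λ) :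
    Commute (plusProj Λ V) (extend h a) := by
  rw [Commute, SemiconjBy, plusProj_mul_extend, plusProj_eq_splitProd h, extend_eq_splitProd,
    splitProd_mul, one_mul, mul_one]

theorem trace_plusProj_mul_extend (h : Λ ⊆ V) (a : Op Λ) :
    (plusProj Λ V * extend h a).trace = a.trace := by
  rw [plusProj_mul_extend, trace_splitProd]
  have h1 : plusSite.trace = 1 := by
    norm_num [plusSite, Matrix.trace, Fin.sum_univ_two]
  have h2 : (prodMatrix fun _ : {x : V // (x : Site d) ∉ Λ} => plusSite).trace = 1 := by
    have := Finset.prod_univ_sum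
      (fun _ : {x : V // (x : Site d) ∉ Λ} => (Finset.univ : Finset (Fin 2))) (fun _ a => plusSite a a)
    rw [Fintype.piFinset_univ] at this
    refine this.symm.trans (Finset.prod_eq_one fun x _ => h1)
  rw [h2, mul_one]

/-- Compression by `plusProj` replaces each `S^i_x` with `x ∉ Λ` by its value `plusValue i`. -/
theorem plusProj_mul_spinProd_mul (h : Λ ⊆ V) (i : Fin 2) {A : Finset (Site d)} (hA : A ⊆ V) :
    plusProj Λ V * spinProd V i A * plusProj Λ V =
      plusProj Λ V * extend h (((plusValue i : ℂ) ^ (A \ Λ).card) • spinProd Λ i A) := by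
  rw [plusProj_mul_extend, splitProd_smul_left, ← splitProd_smul_right, plusProj,
    spinProd_eq_tensor, spinProd_eq_tensor, tensor_mul, tensor_mul, tensor_eq_splitProd h]
  congr 1
  · congr 1; funext x; simp
  · ext σ τ
    simp only [prodMatrix, Matrix.of_apply, Matrix.smul_apply, smul_eq_mul]
    have hc : (plusValue i : ℂ) ^ (A \ Λ).card =
        ∏ x : {x : V // (x : Site d) ∉ Λ}, if (x : Site d) ∈ A then (plusValue i : ℂ) else 1 := by
      rw [Finset.prod_ite, Finset.prod_const, Finset.prod_const_one, mul_one]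
      congr 1
      symm
      refine Finset.card_bij (fun x _ => (x : Site d)) ?_ ?_ ?_
      · intro x hx
        exact Finset.mem_sdiff.2 ⟨(Finset.mem_filter.1 hx).2, x.2⟩
      · intro x _ y _ hxy
        exact Subtype.ext (Subtype.ext hxy)
      · intro x hx
        have hx' := Finset.mem_sdiff.1 hx
        exact ⟨⟨⟨x, hA hx'.1⟩, hx'.2⟩, by simpa using hx'.1, rfl⟩
    rw [hc, ← Finset.prod_mul_distrib]
    refine Finset.prod_congr rfl fun x _ => ?_
    rw [if_neg x.2]
    split_ifs
    · rw [plusSite_mul_spin_mul]; rfl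
    · rw [mul_one, plusSite_mul_self, one_mul]

end Boundary

section FieldLimit

variable {d : ℕ} {Λ V : Finset (Site d)}

/-- Minus the Hamiltonian with couplings `J` in the volume `V`. -/
def spinHam (V : Finset (Site d)) (J : Fin 2 → Finset (Site d) → ℝ) : Op V :=
  ∑ A ∈ V.powerset, ∑ i, (J i A : ℂ) • spinProd V i A

/-- The sum of the spins `S¹_x` over the sites `x ∈ V ∖ Λ`. -/
def boundaryField (Λ V : Finset (Site d)) : Op V :=
  ∑ x ∈ Finset.univ.filter (fun x : {x // x ∈ V} => x.1 ∉ Λ), siteSpin 0 x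

/-- Minus the effective Hamiltonian on `Λ` that results when all spins in `V ∖ Λ` are in the state
with `S¹ = 1/2`. -/
def plusHam (J : Fin 2 → Finset (Site d) → ℝ) (Λ V : Finset (Site d)) : Op Λ :=
  ∑ A ∈ V.powerset, ∑ i, (J i A : ℂ) • ((plusValue i : ℂ) ^ (A \ Λ).card • spinProd Λ i A)

theorem isHermitian_real_smul {n : Type*} {a : Matrix n n ℂ} (ha : a.IsHermitian) (c : ℝ) :
    ((c : ℂ) • a).IsHermitian := by
  rw [Matrix.IsHermitian, Matrix.conjTranspose_smul, ha.eq]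
  simp

theorem isHermitian_spinHam (V : Finset (Site d)) (J : Fin 2 → Finset (Site d) → ℝ) :
    (spinHam V J).IsHermitian :=
  isSelfAdjoint_sum _ fun A _ => isSelfAdjoint_sum _ fun i _ =>
    isHermitian_real_smul (isHermitian_spinProd V i A) _

theorem isHermitian_plusHam (J : Fin 2 → Finset (Site d) → ℝ) (Λ V : Finset (Site d)) :
    (plusHam J Λ V).IsHermitian :=
  isSelfAdjoint_sum _ fun A _ => isSelfAdjoint_sum _ fun i _ =>
    isHermitian_real_smul (by
      rw [← Complex.ofReal_pow]
      exact isHermitian_real_smul (isHermitian_spinProd Λ i A) _) _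

theorem isHermitian_siteSpin (i : Fin 2) (x : V) : (siteSpin i x).IsHermitian := by
  rw [siteSpin_eq_spinProd]; exact isHermitian_spinProd _ _ _

theorem isHermitian_boundaryField : (boundaryField Λ V).IsHermitian :=
  isSelfAdjoint_sum _ fun x _ => isHermitian_siteSpin 0 x

theorem siteSpin_mul_self (i : Fin 2) (x : V) :
    siteSpin i x * siteSpin i x = (1 / 4 : ℂ) • 1 := by
  rw [siteSpin, tensor_mul, ← prodMatrix_one, ← Function.update_eq_self x (fun _ : V =>
    (1 : Matrix (Fin 2) (Fin 2) ℂ)), ← prodMatrix_update_smul, tensor_eq_prodMatrix]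
  congr 1
  funext y
  by_cases h : y = x
  · subst h; simp [spin_mul_self]
  · simp [h]

theorem spinProd_mul_self (V : Finset (Site d)) (i : Fin 2) (A : Finset (Site d)) :
    ∃ r : ℂ, r ≤ 1 ∧ spinProd V i A * spinProd V i A = r • 1 := by
  refine ⟨∏ x : V, if (x : Site d) ∈ A then 1 / 4 else 1, ?_, ?_⟩
  · refine Finset.prod_le_one (fun x _ => ?_) (fun x _ => ?_)
    · split_ifs <;> norm_num [Complex.le_def]
    · split_ifs
      · norm_num [Complex.le_def]
      · exact le_rfl
  · have h := prodMatrix_diagonal (fun (x : V) (_ : Fin 2) =>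
      if (x : Site d) ∈ A then (1 / 4 : ℂ) else 1)
    rw [Matrix.smul_one_eq_diagonal, ← h, spinProd_eq_tensor, tensor_mul, tensor_eq_prodMatrix]
    congr 1
    funext x
    split_ifs
    · rw [spin_mul_self, Matrix.smul_one_eq_diagonal]
    · simp

theorem plusProj_mul_spinHam_mul (h : Λ ⊆ V) (J : Fin 2 → Finset (Site d) → ℝ) :
    plusProj Λ V * spinHam V J * plusProj Λ V = plusProj Λ V * extend h (plusHam J Λ V) := by
  change _ = plusProj Λ V * extendHom h (plusHam J Λ V)
  simp only [spinHam, plusHam, map_sum, Finset.mul_sum, Finset.sum_mul]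
  refine Finset.sum_congr rfl fun A hA => Finset.sum_congr rfl fun i _ => ?_
  rw [mul_smul_comm, smul_mul_assoc, plusProj_mul_spinProd_mul h i (Finset.mem_powerset.1 hA),
    map_smul, mul_smul_comm]
  rfl

/-- The unnormalized matrix of eigenvectors of `S¹`. -/
def hadamard : Matrix (Fin 2) (Fin 2) ℂ := !![1, 1; 1, -1]

/-- `(1/2) • hadamard` is the inverse of `hadamard`, so this is a conjugation. -/
theorem hadamard_conj_diagonal (v : Fin 2 → ℂ) :
    hadamard * Matrix.diagonal v * ((1 / 2 : ℂ) • hadamard) =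
      (1 / 2 : ℂ) • !![v 0 + v 1, v 0 - v 1; v 0 - v 1, v 0 + v 1] := by
  ext a b
  fin_cases a <;> fin_cases b <;>
    simp [hadamard, Matrix.mul_apply, Fin.sum_univ_two, Matrix.vecMul_diagonal] <;> ring

theorem prod_hadamard_conj (v : V → Fin 2 → ℂ) :
    prodMatrix (fun _ : V => hadamard) * Matrix.diagonal (fun σ => ∏ x, v x (σ x)) *
      prodMatrix (fun _ : V => (1 / 2 : ℂ) • hadamard) =
    tensor fun x => (1 / 2 : ℂ) •
      !![v x 0 + v x 1, v x 0 - v x 1; v x 0 - v x 1, v x 0 + v x 1] := by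
  rw [← prodMatrix_diagonal, prodMatrix_mul, prodMatrix_mul, tensor_eq_prodMatrix]
  congr 1
  funext x
  rw [hadamard_conj_diagonal]

theorem prod_hadamard_mul :
    prodMatrix (fun _ : V => hadamard) * prodMatrix (fun _ : V => (1 / 2 : ℂ) • hadamard) = 1 := by
  have := prod_hadamard_conj (fun (_ : V) (_ : Fin 2) => 1)
  simp only [Finset.prod_const_one, Matrix.diagonal_one, mul_one] at this
  rw [this, ← prodMatrix_one, tensor_eq_prodMatrix]
  congr 1
  funext x
  ext a b
  fin_cases a <;> fin_cases b <;> norm_num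

theorem siteSpin_zero_eq (x : V) :
    siteSpin 0 x = prodMatrix (fun _ : V => hadamard) *
      Matrix.diagonal (fun σ : V → Fin 2 => if σ x = 0 then (1 / 2 : ℂ) else -1 / 2) *
      prodMatrix (fun _ : V => (1 / 2 : ℂ) • hadamard) := by
  have := prod_hadamard_conj (fun (y : V) (s : Fin 2) =>
    if y = x then (if s = 0 then (1 / 2 : ℂ) else -1 / 2) else 1)
  simp only [Finset.prod_ite_eq', Finset.mem_univ, if_true] at this
  rw [this, siteSpin]
  congr 1
  funext y
  by_cases h : y = x
  · subst h
    ext a b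
    fin_cases a <;> fin_cases b <;> norm_num [spin]
  · ext a b
    fin_cases a <;> fin_cases b <;> norm_num [h]

theorem plusProj_eq :
    plusProj Λ V = prodMatrix (fun _ : V => hadamard) *
      Matrix.diagonal (fun σ : V → Fin 2 => ∏ x : V,
        if (x : Site d) ∉ Λ ∧ σ x ≠ 0 then (0 : ℂ) else 1) *
      prodMatrix (fun _ : V => (1 / 2 : ℂ) • hadamard) := by
  rw [prod_hadamard_conj (fun (x : V) (s : Fin 2) =>
    if (x : Site d) ∉ Λ ∧ s ≠ 0 then (0 : ℂ) else 1), plusProj]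
  congr 1
  funext x
  by_cases h : (x : Site d) ∈ Λ
  · ext a b
    fin_cases a <;> fin_cases b <;> norm_num [h]
  · ext a b
    fin_cases a <;> fin_cases b <;> norm_num [h, plusSite]

/-- The field term, shifted so that its largest eigenvalue is `0`. -/
def shiftedField (Λ V : Finset (Site d)) : Op V :=
  ∑ x ∈ Finset.univ.filter (fun x : {x // x ∈ V} => x.1 ∉ Λ), (siteSpin 0 x - (1 / 2 : ℂ) • 1)

theorem boundaryField_eq : ∃ c : ℂ, boundaryField Λ V = shiftedField Λ V + c • 1 := by
  refine ⟨∑ x ∈ Finset.univ.filter (fun x : {x // x ∈ V} => x.1 ∉ Λ), (1 / 2 : ℂ), ?_⟩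
  rw [Finset.sum_smul, shiftedField, ← Finset.sum_add_distrib, boundaryField]
  simp

/-- Diagonalization of the shifted field: its eigenvalues are minus the numbers of sites outside `Λ`
with `S¹ = -1/2`. -/
theorem shiftedField_eq :
    shiftedField Λ V = prodMatrix (fun _ : V => hadamard) *
      Matrix.diagonal (fun σ : V → Fin 2 =>
        -((Finset.univ.filter fun x : V => (x : Site d) ∉ Λ ∧ σ x ≠ 0).card : ℂ)) *
      prodMatrix (fun _ : V => (1 / 2 : ℂ) • hadamard) := by
  have h1 : ∀ x : V, siteSpin 0 x - (1 / 2 : ℂ) • 1 = prodMatrix (fun _ : V => hadamard) *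
      Matrix.diagonal (fun σ : V → Fin 2 => if σ x ≠ 0 then (-1 : ℂ) else 0) *
      prodMatrix (fun _ : V => (1 / 2 : ℂ) • hadamard) := by
    intro x
    have h2 : (1 / 2 : ℂ) • (1 : Op V) = prodMatrix (fun _ : V => hadamard) *
        Matrix.diagonal (fun σ : V → Fin 2 => (1 / 2 : ℂ)) *
        prodMatrix (fun _ : V => (1 / 2 : ℂ) • hadamard) := by
      rw [← Matrix.smul_one_eq_diagonal, mul_smul_comm, mul_one, smul_mul_assoc,
        prod_hadamard_mul]
    rw [h2, siteSpin_zero_eq, ← sub_mul, ← mul_sub, Matrix.diagonal_sub]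
    congr 3
    funext σ
    by_cases h : σ x = 0 <;> norm_num [h]
  rw [shiftedField, Finset.sum_congr rfl fun x _ => h1 x, ← Finset.sum_mul, ← Finset.mul_sum]
  congr 2
  ext σ τ
  rw [Matrix.sum_apply]
  by_cases h : σ = τ
  · subst h
    simp only [Matrix.diagonal_apply_eq]
    rw [← Finset.sum_filter, Finset.filter_filter, Finset.sum_const, nsmul_eq_mul]
    ring
  · simp [Matrix.diagonal_apply_ne _ h]

theorem shiftedField_mul_plusProj : shiftedField Λ V * plusProj Λ V = 0 := by
  rw [shiftedField_eq, plusProj_eq]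
  have h : ∀ U D U' D' : Op V, U' * U = 1 → D * D' = 0 → U * D * U' * (U * D' * U') = 0 := by
    intro U D U' D' h1 h2
    calc U * D * U' * (U * D' * U') = U * D * (U' * U) * D' * U' := by simp only [mul_assoc]
      _ = U * (D * D') * U' := by rw [h1]; simp only [mul_assoc, mul_one]
      _ = 0 := by rw [h2]; simp
  refine h _ _ _ _ (mul_eq_one_comm.1 prod_hadamard_mul) ?_
  rw [Matrix.diagonal_mul_diagonal, ← Matrix.diagonal_zero]
  congr 1
  funext σ
  by_cases hσ : ∃ x : V, (x : Site d) ∉ Λ ∧ σ x ≠ 0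
  · obtain ⟨x, hx⟩ := hσ
    rw [Finset.prod_eq_zero (f := fun y : V => if (y : Site d) ∉ Λ ∧ σ y ≠ 0 then (0 : ℂ) else 1)
      (Finset.mem_univ x) (if_pos hx), mul_zero]
  · have : (Finset.univ.filter fun x : V => (x : Site d) ∉ Λ ∧ σ x ≠ 0) = ∅ :=
      Finset.filter_eq_empty_iff.2 fun x _ hx => hσ ⟨x, hx⟩
    rw [this]; simp

theorem exists_shiftedField_mul_eq :
    ∃ G : Op V, shiftedField Λ V * G = 1 - plusProj Λ V := by
  -- `0⁻¹ = 0` makes the entrywise inverse a pseudo-inverse.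
  refine ⟨prodMatrix (fun _ : V => hadamard) * Matrix.diagonal (fun σ : V → Fin 2 =>
      (-((Finset.univ.filter fun x : V => (x : Site d) ∉ Λ ∧ σ x ≠ 0).card : ℂ))⁻¹) *
      prodMatrix (fun _ : V => (1 / 2 : ℂ) • hadamard), ?_⟩
  rw [shiftedField_eq, plusProj_eq]
  have h : ∀ U D U' D' P : Op V, U * U' = 1 → D * D' = 1 - P →
      U * D * U' * (U * D' * U') = 1 - U * P * U' := by
    intro U D U' D' P h1 h2
    calc U * D * U' * (U * D' * U') = U * D * (U' * U) * D' * U' := by simp only [mul_assoc]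
      _ = U * (D * D') * U' := by rw [mul_eq_one_comm.1 h1]; simp only [mul_assoc, one_mul]
      _ = 1 - U * P * U' := by rw [h2, mul_sub, sub_mul, mul_one, h1]
  refine h _ _ _ _ _ prod_hadamard_mul ?_
  rw [Matrix.diagonal_mul_diagonal, ← Matrix.diagonal_one, Matrix.diagonal_sub]
  congr 1
  funext σ
  by_cases hσ : ∃ x : V, (x : Site d) ∉ Λ ∧ σ x ≠ 0
  · obtain ⟨x, hx⟩ := hσ
    have : ((Finset.univ.filter fun x : V => (x : Site d) ∉ Λ ∧ σ x ≠ 0).card : ℂ) ≠ 0 := by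
      rw [Nat.cast_ne_zero]
      exact Finset.card_ne_zero_of_mem (Finset.mem_filter.2 ⟨Finset.mem_univ x, hx⟩)
    rw [Finset.prod_eq_zero (f := fun y : V => if (y : Site d) ∉ Λ ∧ σ y ≠ 0 then (0 : ℂ) else 1)
      (Finset.mem_univ x) (if_pos hx), mul_inv_cancel₀ (neg_ne_zero.2 this),
      sub_zero]
  · have h0 : (Finset.univ.filter fun x : V => (x : Site d) ∉ Λ ∧ σ x ≠ 0) = ∅ :=
      Finset.filter_eq_empty_iff.2 fun x _ hx => hσ ⟨x, hx⟩
    rw [h0, Finset.prod_congr rfl fun x _ => if_neg fun hx => hσ ⟨x, hx⟩]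
    simp

open scoped MatrixOrder in
/-- `1/2 - S¹_x` is a Hermitian idempotent, hence nonnegative. -/
theorem shiftedField_nonpos : shiftedField Λ V ≤ 0 := by
  refine Finset.sum_nonpos fun x _ => ?_
  have h : (siteSpin 0 x - (1 / 2 : ℂ) • 1 : Op V) =
      -((siteSpin 0 x - (1 / 2 : ℂ) • 1).conjTranspose * (siteSpin 0 x - (1 / 2 : ℂ) • 1)) := by
    have hH : (siteSpin 0 x - (1 / 2 : ℂ) • 1 : Op V).conjTranspose =
        siteSpin 0 x - (1 / 2 : ℂ) • 1 := by
      rw [Matrix.conjTranspose_sub, (isHermitian_siteSpin 0 x).eq, Matrix.conjTranspose_smul]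
      simp
    rw [hH, sub_mul, mul_sub, mul_sub, siteSpin_mul_self, smul_mul_assoc, smul_mul_assoc,
      mul_smul_comm, one_mul, one_mul, mul_one, smul_smul]
    module
  rw [h, neg_nonpos]
  exact Matrix.nonneg_iff_posSemidef.2 (Matrix.posSemidef_conjTranspose_mul_self _)

theorem tendsto_exp_shiftedField {B : Op V} (hB : B.IsHermitian) :
    Tendsto (fun η : ℝ => NormedSpace.exp (B + (η : ℂ) • shiftedField Λ V)) atTop
      (𝓝 (plusProj Λ V * NormedSpace.exp (plusProj Λ V * B * plusProj Λ V))) := by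
  obtain ⟨G, hG⟩ := exists_shiftedField_mul_eq (Λ := Λ) (V := V)
  open scoped Matrix.Norms.L2Operator MatrixOrder in
  exact tendsto_exp_add_smul (A := Op V) hB isHermitian_plusProj shiftedField_nonpos
    shiftedField_mul_plusProj plusProj_mul_self hG

/-- With an infinite field on `V ∖ Λ`, the Gibbs state becomes that of the effective Hamiltonian
on `Λ`. -/
theorem tendsto_gibbs_boundaryField (h : Λ ⊆ V) (J : Fin 2 → Finset (Site d) → ℝ) (a : Op Λ) :
    Tendsto (fun η : ℝ => gibbs (spinHam V J + (η : ℂ) • boundaryField Λ V) (extend h a)) atTop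
      (𝓝 (gibbs (plusHam J Λ V) a)) := by
  obtain ⟨c, hc⟩ := boundaryField_eq (Λ := Λ) (V := V)
  have hlim := tendsto_exp_shiftedField (Λ := Λ) (isHermitian_spinHam V J)
  rw [plusProj_mul_spinHam_mul h, mul_exp_mul plusProj_mul_self (commute_plusProj_extend h _)] at hlim
  have htr : ∀ b : Op Λ, Tendsto (fun η : ℝ => (extend h b *
      NormedSpace.exp (spinHam V J + (η : ℂ) • shiftedField Λ V)).trace) atTop
      (𝓝 (b * NormedSpace.exp (plusHam J Λ V)).trace) := by
    intro b
    have hcont : Continuous fun X : Op V => (extend h b * X).trace := by fun_prop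
    have := (hcont.tendsto _).comp hlim
    have e : (extend h b * (plusProj Λ V * NormedSpace.exp (extend h (plusHam J Λ V)))).trace =
        (b * NormedSpace.exp (plusHam J Λ V)).trace := by
      have h1 : NormedSpace.exp (extend h (plusHam J Λ V)) =
          extend h (NormedSpace.exp (plusHam J Λ V)) := (algHom_exp (extendHom h) _).symm
      rw [h1, ← mul_assoc, ← (commute_plusProj_extend h b).eq, mul_assoc]
      have h2 : extend h b * extend h (NormedSpace.exp (plusHam J Λ V)) =
        extend h (b * NormedSpace.exp (plusHam J Λ V)) := (map_mul (extendHom h) _ _).symm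
      rw [h2, trace_plusProj_mul_extend]
    rw [e] at this
    exact this
  have hone := htr 1
  have h1 : extend h (1 : Op Λ) = 1 := map_one (extendHom h)
  simp only [h1, one_mul] at hone
  have hne : (NormedSpace.exp (plusHam J Λ V)).trace ≠ 0 :=
    (trace_exp_pos (isHermitian_plusHam J Λ V)).ne'
  refine ((htr a).div hone hne).congr fun η => ?_
  change gibbs _ _ = _
  rw [hc, smul_add, smul_smul, ← add_assoc, gibbs_add_smul_one]

end FieldLimit

/-! ### Infinite-volume limit -/

section InfiniteVolume

variable {d : ℕ} {N : SpaceNorm d} {R : ℝ≥0} {J : Fin 2 → Finset (Site d) → ℝ}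

theorem fieldExpectation_eq_gibbs (Λ : Finset (Site d)) (η : ℝ) (a : Op Λ) :
    fieldExpectation N R J Λ η a =
      gibbs (spinHam (enlarge N R Λ) J + (η : ℂ) • boundaryField Λ (enlarge N R Λ))
        (extend (subset_enlarge N R Λ) a) := by
  have h : -hamiltonian N R J Λ η =
      spinHam (enlarge N R Λ) J + (η : ℂ) • boundaryField Λ (enlarge N R Λ) := by
    simp only [hamiltonian, spinHam, boundaryField, Fin.sum_univ_two]
    abel
  rw [fieldExpectation, h, gibbs]

theorem tendsto_fieldExpectation (Λ : Finset (Site d)) (a : Op Λ) :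
    Tendsto (fun η : ℝ => fieldExpectation N R J Λ η a) atTop
      (𝓝 (gibbs (plusHam J Λ (enlarge N R Λ)) a)) := by
  simp only [fieldExpectation_eq_gibbs]
  exact tendsto_gibbs_boundaryField (subset_enlarge N R Λ) J a

theorem plusExpectation_eq_gibbs (Λ : Finset (Site d)) (a : Op Λ) :
    plusExpectation N R J Λ a = gibbs (plusHam J Λ (enlarge N R Λ)) a :=
  (tendsto_fieldExpectation Λ a).limUnder_eq

theorem enlarge_mono {Λ Λ' : Finset (Site d)} (h : Λ ⊆ Λ') : enlarge N R Λ ⊆ enlarge N R Λ' := by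
  intro x hx
  simp only [enlarge, Set.Finite.mem_toFinset, Set.mem_ofPred_eq] at hx ⊢
  obtain ⟨y, hy, hxy⟩ := hx
  exact ⟨y, h hy, hxy⟩

/-- By the finite range of the couplings, sites outside `Λ_R` contribute only a constant to the
effective Hamiltonian on `Λ`. -/
theorem exists_plusHam_eq (hR : HasRange N R J) {Λ V : Finset (Site d)}
    (h : enlarge N R Λ ⊆ V) :
    ∃ c : ℂ, plusHam J Λ V = plusHam J Λ (enlarge N R Λ) + c • 1 := by
  refine ⟨∑ A ∈ V.powerset \ (enlarge N R Λ).powerset, ∑ i,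
    (J i A : ℂ) * (plusValue i : ℂ) ^ (A \ Λ).card, ?_⟩
  rw [plusHam, ← Finset.sum_sdiff (Finset.powerset_mono.2 h), add_comm, plusHam, Finset.sum_smul]
  congr 1
  refine Finset.sum_congr rfl fun A hA => ?_
  rw [Finset.sum_smul]
  refine Finset.sum_congr rfl fun i _ => ?_
  rw [smul_smul]
  have hA' : ¬ A ⊆ enlarge N R Λ := fun h => (Finset.mem_sdiff.1 hA).2 (Finset.mem_powerset.2 h)
  obtain ⟨y, hyA, hy⟩ := Finset.not_subset.1 hA'
  by_cases hd : ∃ x ∈ A, x ∈ Λ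
  · obtain ⟨x, hxA, hx⟩ := hd
    have : J i A = 0 := hR i A ⟨y, hyA, x, hxA, by
      by_contra hle
      refine hy ?_
      simp only [enlarge, Set.Finite.mem_toFinset, Set.mem_ofPred_eq]
      exact ⟨x, hx, not_lt.1 hle⟩⟩
    simp [this]
  · congr 1
    rw [spinProd_eq_tensor, ← prodMatrix_one, tensor_eq_prodMatrix]
    congr 1
    funext x
    rw [if_neg fun hx => hd ⟨x, hx, x.2⟩]

/-- The Hamiltonians with the same field outside `Λ` and outside `Λ' ⊇ Λ` satisfy the hypothesis
of `ginibre_inequality`. -/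
theorem doublePos_boundaryField (hJ : ∀ i A, 0 ≤ J i A) {Λ Λ' V : Finset (Site d)} (h : Λ ⊆ Λ')
    {η : ℝ} (hη : 0 ≤ η) :
    DoublePos V (doubleLeft V (spinHam V J + (η : ℂ) • boundaryField Λ V) +
      doubleRight V (spinHam V J + (η : ℂ) • boundaryField Λ' V)) := by
  have hη' : (0 : ℂ) ≤ η := by exact_mod_cast hη
  have h1 : DoublePos V (doubleLeft V (spinHam V J) + doubleRight V (spinHam V J)) := by
    simp only [spinHam, map_sum, map_smul, ← Finset.sum_add_distrib, ← smul_add]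
    exact .sum fun A _ => .sum fun i _ =>
      .smul (by exact_mod_cast hJ i A) (ginibrePos_spinProd i A).1
  have h2 : DoublePos V (doubleLeft V (boundaryField Λ V) +
      doubleRight V (boundaryField Λ' V)) := by
    have hsub : Finset.univ.filter (fun x : {x // x ∈ V} => x.1 ∉ Λ') ⊆
        Finset.univ.filter (fun x : {x // x ∈ V} => x.1 ∉ Λ) :=
      Finset.monotone_filter_right _ fun x _ hx hx' => hx (h hx')
    rw [boundaryField, ← Finset.sum_sdiff hsub, boundaryField, map_add, add_assoc]
    simp only [map_sum, ← Finset.sum_add_distrib]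
    refine .add (.sum fun x _ => ?_) (.sum fun x _ => (ginibrePos_siteSpin 0 x).1)
    exact GinibrePos.doubleLeft (by simpa using ginibrePos_siteSpin 0 x)
  have e : doubleLeft V (spinHam V J + (η : ℂ) • boundaryField Λ V) +
      doubleRight V (spinHam V J + (η : ℂ) • boundaryField Λ' V) =
      (doubleLeft V (spinHam V J) + doubleRight V (spinHam V J)) +
        (η : ℂ) • (doubleLeft V (boundaryField Λ V) + doubleRight V (boundaryField Λ' V)) := by
    rw [map_add, map_add, map_smul, map_smul, smul_add]; abel
  rw [e]
  exact .add h1 (.smul hη' h2)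

/-- A field on more sites raises the expectations of products of `S¹` and lowers those of products
of `S²`. The order is that of `ℂ`, so the inequality includes equality of the imaginary parts. -/
theorem gibbs_boundaryField_le (hJ : ∀ i A, 0 ≤ J i A) {Λ Λ' V : Finset (Site d)} (h : Λ ⊆ Λ')
    (i : Fin 2) (A : Finset (Site d)) {η : ℝ} (hη : 0 ≤ η) :
    (-1) ^ (i : ℕ) * gibbs (spinHam V J + (η : ℂ) • boundaryField Λ' V) (spinProd V i A) ≤
      (-1) ^ (i : ℕ) * gibbs (spinHam V J + (η : ℂ) • boundaryField Λ V) (spinProd V i A) := by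
  have hpos : ∀ Λ : Finset (Site d),
      0 < (NormedSpace.exp (spinHam V J + (η : ℂ) • boundaryField Λ V)).trace := fun Λ =>
    trace_exp_pos ((isHermitian_spinHam V J).add
      (isHermitian_real_smul isHermitian_boundaryField η))
  have ha : DoublePos V (doubleLeft V ((-1 : ℂ) ^ (i : ℕ) • spinProd V i A) -
      doubleRight V ((-1 : ℂ) ^ (i : ℕ) • spinProd V i A)) := by
    rw [map_smul, map_smul, ← smul_sub]
    exact (ginibrePos_spinProd i A).2
  have := ginibre_inequality (doublePos_boundaryField hJ h hη) ha
  rw [← gibbs_smul, ← gibbs_smul, gibbs, gibbs, div_le_div_iff₀ (hpos Λ') (hpos Λ)]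
  rwa [mul_comm] at this

/-- Expectations of products of `S¹` decrease with the volume, those of products of `S²`
increase: the smaller volume has the same interactions and a field in more places. -/
theorem plusExpectation_spinProd_le (hJ : ∀ i A, 0 ≤ J i A) (hR : HasRange N R J)
    {Λ Λ' A : Finset (Site d)} (h : Λ ⊆ Λ') (hA : A ⊆ Λ) (i : Fin 2) :
    (-1) ^ (i : ℕ) * plusExpectation N R J Λ' (spinProd Λ' i A) ≤
      (-1) ^ (i : ℕ) * plusExpectation N R J Λ (spinProd Λ i A) := by
  have hΛ : Λ ⊆ enlarge N R Λ' := h.trans (subset_enlarge N R Λ')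
  have hlim' := tendsto_gibbs_boundaryField (subset_enlarge N R Λ') J (spinProd Λ' i A)
  have hlim := tendsto_gibbs_boundaryField hΛ J (spinProd Λ i A)
  obtain ⟨c, hc⟩ := exists_plusHam_eq hR (enlarge_mono (N := N) (R := R) h)
  rw [extend_spinProd _ i (hA.trans h)] at hlim'
  rw [extend_spinProd _ i hA, hc, gibbs_add_smul_one] at hlim
  rw [plusExpectation_eq_gibbs, plusExpectation_eq_gibbs]
  have := Complex.orderClosedTopology
  refine le_of_tendsto_of_tendsto (hlim'.const_mul _) (hlim.const_mul _) ?_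
  filter_upwards [eventually_ge_atTop 0] with η hη
  exact gibbs_boundaryField_le hJ h i A hη

theorem neg_one_le_plusExpectation_spinProd (Λ A : Finset (Site d)) (i : Fin 2) :
    -1 ≤ (-1) ^ (i : ℕ) * plusExpectation N R J Λ (spinProd Λ i A) := by
  obtain ⟨r, hr, hrr⟩ := spinProd_mul_self Λ i A
  rw [plusExpectation_eq_gibbs, ← gibbs_smul, neg_le, ← gibbs_neg]
  have hε : ((-1 : ℂ) ^ (i : ℕ)) * (-1) ^ (i : ℕ) = 1 := by
    rw [← mul_pow]; norm_num
  refine gibbs_le_one (isHermitian_plusHam J Λ _) ?_ hr (r := r) ?_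
  · have := isHermitian_real_smul (isHermitian_spinProd Λ i A) ((-1) ^ (i : ℕ))
    push_cast at this
    exact this.neg
  · rw [neg_mul_neg, smul_mul_smul_comm, hε, one_smul, hrr]

theorem exists_tendstoInfiniteVolume (hJ : ∀ i A, 0 ≤ J i A) (hR : HasRange N R J)
    (A : Finset (Site d)) (i : Fin 2) :
    ∃ t : ℂ, TendstoInfiniteVolume
      (fun Λ => plusExpectation N R J Λ (spinProd Λ i A)) t := by
  set f : Finset (Site d) → ℂ := fun Λ => plusExpectation N R J Λ (spinProd Λ i A) with hf
  have hε : ((-1 : ℂ) ^ (i : ℕ)) * (-1) ^ (i : ℕ) = 1 := by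
    rw [← mul_pow]; norm_num
  -- Replacing `Λ` by `Λ ∪ A` makes the monotonicity hold for all volumes.
  set g : Finset (Site d) → ℂ := fun Λ => (-1) ^ (i : ℕ) * f (Λ ∪ A) with hg
  have hanti : Antitone g := fun Λ Λ' h =>
    plusExpectation_spinProd_le hJ hR (Finset.union_subset_union_left h)
      Finset.subset_union_right i
  have hbdd : ∀ Λ, -1 ≤ g Λ := fun Λ => neg_one_le_plusExpectation_spinProd _ _ _
  have hre : Tendsto (fun Λ => (g Λ).re) atTop (𝓝 (⨅ Λ, (g Λ).re)) :=
    tendsto_atTop_ciInf (fun Λ Λ' h => (Complex.le_def.1 (hanti h)).1)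
      ⟨-1, by rintro _ ⟨Λ, rfl⟩; simpa using (Complex.le_def.1 (hbdd Λ)).1⟩
  have hgre : ∀ Λ, ((g Λ).re : ℂ) = g Λ := fun Λ =>
    Complex.ext rfl (by simpa using (Complex.le_def.1 (hbdd Λ)).2)
  refine ⟨(-1) ^ (i : ℕ) * ((⨅ Λ, (g Λ).re : ℝ) : ℂ), fun Λ hΛ hcof => ?_⟩
  have hat : Tendsto Λ atTop atTop := tendsto_atTop.2 fun B => by
    obtain ⟨n, hn⟩ := hcof B
    exact eventually_atTop.2 ⟨n, hn⟩
  have hlim := ((Complex.continuous_ofReal.tendsto _).comp (hre.comp hat)).const_mul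
    ((-1 : ℂ) ^ (i : ℕ))
  refine hlim.congr' ?_
  obtain ⟨n, hn⟩ := hcof A
  filter_upwards [eventually_ge_atTop n] with k hk
  simp only [Function.comp_apply, hgre]
  rw [hg]
  simp only
  rw [← mul_assoc, hε, one_mul, Finset.union_eq_left.2 (hn k hk)]

end InfiniteVolume

end QuantumXY

end

theorem theorem3 (d : ℕ) (N : QuantumXY.SpaceNorm d) (R : ℝ≥0)
    (J : Fin 2 → Finset (QuantumXY.Site d) → ℝ)
    (hJ : ∀ i A, 0 ≤ J i A) (hR : QuantumXY.HasRange N R J) :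
    (∀ (Λ : Finset (QuantumXY.Site d)) (a : QuantumXY.Op Λ), ∃ l : ℂ,
      Tendsto (fun η : ℝ => QuantumXY.fieldExpectation N R J Λ η a) atTop (𝓝 l)) ∧
    ∀ (A : Finset (QuantumXY.Site d)) (i : Fin 2), ∃ t : ℂ,
      QuantumXY.TendstoInfiniteVolume
        (fun Λ => QuantumXY.plusExpectation N R J Λ (QuantumXY.spinProd Λ i A)) t :=
  ⟨fun Λ a => ⟨_, QuantumXY.tendsto_fieldExpectation Λ a⟩,
    fun A i => QuantumXY.exists_tendstoInfiniteVolume hJ hR A i⟩
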